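/- Let $Z\in\mathbb{R}^{n\times k}$ ($k\ge 1$) be a random matrix with i.i.d. entries satisfying $\mathbb{E}Z_{ij}=\mathbb{E}Z_{ij}^3=0$, $\mathbb{E}Z_{ij}^2=1$, $\mathbb{E}Z_{ij}^4=\kappa>3$, and $\mathbb{E}\exp(\lambda Z_{ij})\le e^{c\lambda^2}$ for all $\lambda\in\mathbb{R}$. Let $\mathcal{O}(k)$ be the set of $k\times k$ orthogonal matrices, let $R^*\in\mathcal{O}(k)$ be fixed, let $\hat Z=ZR^*$, and let the (centered) Varimax estimator $\hat R$ be any maximizer $$\hat R\in\mathop{\rm arg\,max}_{R\in\mathcal{O}(k)}\sum_{i=1}^n\sum_{j=1}^k\big((\hat ZR^\top)_{ij}\big)^4 .$$ Put ${\rm dist}(R^*,\hat R)=\min_{P\in\mathcal{P}(k)}\|\hat R-PR^*\|_{\rm F}/\|R^*\|_{\rm F}$, where $\|\cdot\|_{\rm F}$ is the Frobenius norm and $\mathcal{P}(k)$ is the set of orthogonal $k\times k$ matrices with all entries in $\{0,\pm1\}$. Theorem. Fix constants $c>0$, $C_0>3$ and $\delta\in(0,1/2]$. There are constants $C,c_1>0$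 depending only on $c,C_0,\delta$ such that the following hold, where $n$, $k$, $\kappa\in(3,C_0]$, the law of the entries and $R^*$ may vary together and the convergence is uniform over all of them subject to the stated conditions. (i) If $n\ge C\max\left\{\frac{k\log n}{(\kappa-3)^2},\frac{k^2\log^2 n}{\kappa-3}\right\}$, then $\mathbb{P}({\rm dist}(R^*,\hat R)\ge\delta)\to0$ as $n\to\infty$: for every $\varepsilon>0$ there is $N$, depending only on $c,C_0,\delta,\varepsilon$, such that this probability is at most $\varepsilon$ whenever $n\ge N$. (ii) If $k<n\le c_1k^2$, then $\mathbb{P}({\rm dist}(R^*,\hat R)\ge\delta)\to1$ as $n,k\to\infty$: for every $\varepsilon>0$ there is $N$, depending only on $c,C_0,\delta,\varepsilon$, such that this probability is at least $1-\varepsilon$ whenever $n,k\ge N$. -/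

import Mathlib

open MeasureTheory ProbabilityTheory
open scoped Matrix NNReal

namespace VarimaxRotation

/-- The entries of the random `n × k` matrix `Z` are i.i.d. with
`E Z_ij = E Z_ij ^ 3 = 0`, `E Z_ij ^ 2 = 1`, `E Z_ij ^ 4 = κ`, and are sub-Gaussian:
`E exp (t Z_ij) ≤ exp (c t ^ 2)` for all real `t`. (Mathlib's variance proxy `v` bounds the
moment generating function by `exp (v t ^ 2 / 2)`, so it is `2 * c` here; it also includes the
integrability of `exp (t Z_ij)`, hence all moments below are those of integrable variables.) -/
structure IsFactorMatrix {Ω : Type*} [MeasurableSpace Ω] (P : Measure Ω) {n k : ℕ}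
    (c : ℝ≥0) (κ : ℝ) (Z : Ω → Matrix (Fin n) (Fin k) ℝ) : Prop where
  indep : iIndepFun (fun (p : Fin n × Fin k) (ω : Ω) => Z ω p.1 p.2) P
  ident : ∀ p q : Fin n × Fin k,
    IdentDistrib (fun ω => Z ω p.1 p.2) (fun ω => Z ω q.1 q.2) P P
  moment_one : ∀ i j, ∫ ω, Z ω i j ∂P = 0
  moment_two : ∀ i j, ∫ ω, Z ω i j ^ 2 ∂P = 1
  moment_three : ∀ i j, ∫ ω, Z ω i j ^ 3 ∂P = 0
  moment_four : ∀ i j, ∫ ω, Z ω i j ^ 4 ∂P = κ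
  subgaussian : ∀ i j, HasSubgaussianMGF (fun ω => Z ω i j) (2 * c) P

/-- The centered Varimax objective `∑ i, ∑ j, ((Y Rᵀ) i j) ^ 4`. -/
def varimaxObjective {n k : ℕ} (Y : Matrix (Fin n) (Fin k) ℝ) (R : Matrix (Fin k) (Fin k) ℝ) :
    ℝ :=
  ∑ i, ∑ j, ((Y * Rᵀ) i j) ^ 4

/-- `R` is a maximizer of the centered Varimax objective over the orthogonal group `O(k)`. -/
def IsVarimax {n k : ℕ} (Y : Matrix (Fin n) (Fin k) ℝ) (R : Matrix (Fin k) (Fin k) ℝ) : Prop :=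
  R ∈ Matrix.orthogonalGroup (Fin k) ℝ ∧
    ∀ Q ∈ Matrix.orthogonalGroup (Fin k) ℝ, varimaxObjective Y Q ≤ varimaxObjective Y R

/-- Signed permutation matrices: the orthogonal matrices with all entries in `{0, 1, -1}`. -/
def signedPermutations (k : ℕ) : Set (Matrix (Fin k) (Fin k) ℝ) :=
  {P | P ∈ Matrix.orthogonalGroup (Fin k) ℝ ∧ ∀ i j, P i j = 0 ∨ P i j = 1 ∨ P i j = -1}

section Frobenius

attribute [local instance] Matrix.frobeniusNormedAddCommGroup

/-- `dist(R*, R̂) = min_P ‖R̂ - P R*‖_F / ‖R*‖_F`, with `P` running over the (finite, nonempty)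
set of signed permutation matrices and `‖·‖_F` the Frobenius norm. -/
noncomputable def rotationDist {k : ℕ} (Rstar Rhat : Matrix (Fin k) (Fin k) ℝ) : ℝ :=
  ⨅ P : signedPermutations k, ‖Rhat - (P : Matrix (Fin k) (Fin k) ℝ) * Rstar‖ / ‖Rstar‖

end Frobenius

end VarimaxRotation

/-!
The parts of the theorem rest on opposite behaviours of the fourth moment
`φ(u) = ∑ i, ⟨u, Z i⟩ ^ 4` of the data in a direction `u`. As the objective is invariant under
`(Ẑ, R) ↦ (Z, R R*ᵀ)`, the matrix `V = R̂ R*ᵀ` maximizes `∑ j, φ(V j)` over orthogonal matrices, and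
`dist(R*, R̂) < δ` says that `V` is within `δ √k` of a signed permutation in Frobenius norm.

**Consistency.** The mean of `φ(u)` is `n (3 + (κ - 3) ∑ l, u l ^ 4)` for unit `u`. On a grid of
mesh `n ^ (-10)` in the unit ball, `φ(u)` exceeds its mean by at most `n η`, with `η` a small
multiple of `κ - 3`: the fourth powers are split at the level `B ^ 2 ≍ log ^ 2 n`, where the
truncated part has a Bernstein bound and the sum of the large *squares* has exponential moments
(`IsFactorVector.prob_pow_four_le`). The two terms in the lower bound on `n` are what the union
bound over `exp (O(k log n))` grid points needs (`IsFactorVector.prob_grid_pow_four`). Only the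
upper tail is needed uniformly; at the identity, Chebyshev's inequality bounds the objective from
below (`IsFactorVector.prob_sum_pow_four`). Optimality then gives `k - ∑ V j l ^ 4 ≤ 3 k η / (κ - 3)`
(`IsVarimax.sum_pow_four_ge`), and an orthogonal matrix with nearly maximal `∑ V j l ^ 4` is close
to a signed permutation (`exists_signedPermutation_near`).

**Inconsistency.** For `n ≤ c₁ k ^ 2` the maximum is reached by overfitting. Gram-Schmidt on the
first `k` data rows gives an orthonormal basis whose `j`-th vector has squared inner product about
`k - j` with the `j`-th row, so the maximum is at least about `k ^ 3 / 3`
(`IsVarimax.objective_ge`); the errors are controlled in mean, because a row is independent of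
the span of the earlier ones (`IsFactorVector.lintegral_gs_projection_le`). On the other hand
`φ(u) ≤ 1.5 k ^ 2` for all unit `u` (`sum_pow_four_le_of_events`): the large values
of `⟨u, Z i⟩ ^ 2` sit on few rows and their sum is at most `1.1 k` (`IsFactorVector.prob_sparse`,
applied to sparse combinations of rows), while the remaining terms are handled by the truncated
bound. If `V` is near a signed permutation `Q`, each row of `V` is a multiple of a row of `Q` plus
an orthogonal part `w`. The first contributes at most a multiple of `∑ Z i j ^ 4 = O(n k)`, which is
small against `k ^ 3`, and the second about `φ(w) ≤ |w| ^ 4 * 1.5 k ^ 2`. Over the rows this stays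
below `k ^ 3 / 3` by a constant factor (`objective_le_of_near_signedPermutation`), so such a `V` is
not a maximizer.
-/

namespace VarimaxRotation

/-! ### Vectors of independent sub-Gaussian entries -/

section

variable {Ω ι : Type*} [MeasurableSpace Ω] {P : Measure Ω} {c : ℝ≥0} {κ : ℝ}

/-- A finite family of independent variables with the moments and the sub-Gaussian bound of the
entries of a factor matrix. The entries are measurable, not merely almost everywhere measurable, and
need not have the same law: only the moments and the bound matter. -/
structure IsFactorVector [Fintype ι] (P : Measure Ω) (c : ℝ≥0) (κ : ℝ)
    (z : ι → Ω → ℝ) : Prop where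
  meas : ∀ a, Measurable (z a)
  indep : iIndepFun z P
  moment_one : ∀ a, ∫ ω, z a ω ∂P = 0
  moment_two : ∀ a, ∫ ω, z a ω ^ 2 ∂P = 1
  moment_three : ∀ a, ∫ ω, z a ω ^ 3 ∂P = 0
  moment_four : ∀ a, ∫ ω, z a ω ^ 4 ∂P = κ
  subgaussian : ∀ a, HasSubgaussianMGF (z a) (2 * c) P

lemma IsFactorMatrix.entries {n k : ℕ} {Z : Ω → Matrix (Fin n) (Fin k) ℝ}
    (h : IsFactorMatrix P c κ Z) (hm : ∀ i j, Measurable fun ω => Z ω i j) :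
    IsFactorVector P c κ (fun (p : Fin n × Fin k) ω => Z ω p.1 p.2) where
  meas p := hm p.1 p.2
  indep := h.indep
  moment_one _ := h.moment_one _ _
  moment_two _ := h.moment_two _ _
  moment_three _ := h.moment_three _ _
  moment_four _ := h.moment_four _ _
  subgaussian _ := h.subgaussian _ _

lemma IsFactorVector.comp_injective [Fintype ι] {ι' : Type*} [Fintype ι'] {z : ι → Ω → ℝ}
    (h : IsFactorVector P c κ z) {g : ι' → ι} (hg : g.Injective) :
    IsFactorVector P c κ (fun a => z (g a)) where
  meas _ := h.meas _
  indep := h.indep.precomp hg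
  moment_one _ := h.moment_one _
  moment_two _ := h.moment_two _
  moment_three _ := h.moment_three _
  moment_four _ := h.moment_four _
  subgaussian _ := h.subgaussian _

/-- Blocks of an independent array are independent. -/
lemma iIndepFun_rows {α β : Type*} [Fintype α] [Fintype β] {z : α × β → Ω → ℝ}
    (hm : ∀ p, Measurable (z p)) (h : iIndepFun z P) :
    iIndepFun (fun (i : α) (ω : Ω) (j : β) => z (i, j) ω) P := by
  have := h.isProbabilityMeasure
  have hp : ∀ p, IsProbabilityMeasure (P.map (z p)) :=
    fun p ↦ Measure.isProbabilityMeasure_map (hm p).aemeasurable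
  rw [iIndepFun_iff_map_fun_eq_infinitePi_map (by fun_prop)]
  have h1 := (iIndepFun_iff_map_fun_eq_infinitePi_map hm).1 h
  have h2 : ∀ i, P.map (fun ω (j : β) => z (i, j) ω)
      = Measure.infinitePi fun j => P.map (z (i, j)) := fun i =>
    (iIndepFun_iff_map_fun_eq_infinitePi_map (fun j => hm (i, j))).1
      (h.precomp (g := fun j => (i, j)) (Prod.mk_right_injective i))
  simp_rw [h2]
  rw [← Measure.infinitePi_map_curry (fun i j ↦ P.map (z (i, j)))]
  have h3 : (fun p : α × β => P.map (z (p.1, p.2))) = fun p => P.map (z p) := rfl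
  rw [h3, ← h1, Measure.map_map (by fun_prop) (by fun_prop)]
  rfl

/-- The rate `a` in the bound `E exp (a X ^ 2) ≤ 2` for sub-Gaussian variables `X` with
`E exp (t X) ≤ exp (c t ^ 2)`. -/
noncomputable def sqRate (c : ℝ≥0) : ℝ := 1 / (8 * (c + 1))

lemma sqRate_pos (c : ℝ≥0) : 0 < sqRate c := by unfold sqRate; positivity

lemma sqRate_le_one (c : ℝ≥0) : sqRate c ≤ 1 := by
  unfold sqRate
  rw [div_le_one (by positivity)]
  have := c.coe_nonneg
  linarith

lemma lintegral_exp_sq_gaussian (c : ℝ≥0) :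
    ∫⁻ x, ENNReal.ofReal (Real.exp (c * x ^ 2)) ∂(gaussianReal 0 (1 / (4 * (c + 1)))) ≤ 2 := by
  have hc := c.coe_nonneg
  have hs : (1 / (4 * (c + 1)) : ℝ≥0) ≠ 0 := by positivity
  rw [gaussianReal_of_var_ne_zero _ hs, lintegral_withDensity_eq_lintegral_mul _
    (measurable_gaussianPDF _ _) (by fun_prop)]
  have h : ∀ x : ℝ, (gaussianPDF 0 (1 / (4 * (c + 1))) * fun x : ℝ =>
      ENNReal.ofReal (Real.exp (c * x ^ 2))) x =
      ENNReal.ofReal ((√(2 * Real.pi * (1 / (4 * (c + 1)))))⁻¹ *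
        Real.exp (-(c + 2 : ℝ) * x ^ 2)) := by
    intro x
    simp only [Pi.mul_apply, gaussianPDF, gaussianPDFReal]
    rw [← ENNReal.ofReal_mul (by positivity), mul_assoc, ← Real.exp_add]
    push_cast
    congr 3
    have : (c : ℝ) + 1 ≠ 0 := by positivity
    field_simp
    ring
  simp_rw [h]
  rw [← ofReal_integral_eq_lintegral_ofReal
    ((integrable_exp_neg_mul_sq (by positivity)).const_mul _)
    (Filter.Eventually.of_forall fun x => by positivity), integral_const_mul,
    integral_gaussian, ← Real.sqrt_inv, ← Real.sqrt_mul (by positivity)]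
  rw [show (2 : ENNReal) = ENNReal.ofReal 2 by simp]
  apply ENNReal.ofReal_le_ofReal
  rw [Real.sqrt_le_left (by norm_num)]
  have hpi := Real.pi_pos
  have : (2 * Real.pi * (1 / (4 * ((c : ℝ) + 1))))⁻¹ * (Real.pi / (c + 2)) =
      2 * (c + 1) / (c + 2) := by
    field_simp
    ring
  rw [this, div_le_iff₀ (by positivity)]
  linarith

/-- Writing `exp (a X ^ 2)` as a Gaussian average of `exp (t X)` turns the bound on the moment
generating function into a bound on the exponential moment of the square. -/
lemma exp_sq_of_subgaussian [IsProbabilityMeasure P] {X : Ω → ℝ} (hX : Measurable X)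
    (h : HasSubgaussianMGF X (2 * c) P) :
    Integrable (fun ω => Real.exp (sqRate c * X ω ^ 2)) P ∧
      ∫ ω, Real.exp (sqRate c * X ω ^ 2) ∂P ≤ 2 := by
  have key : ∫⁻ ω, ENNReal.ofReal (Real.exp (sqRate c * X ω ^ 2)) ∂P ≤ 2 := by
    set γ := gaussianReal 0 (1 / (4 * (c + 1)))
    have h1 : ∀ ω, ENNReal.ofReal (Real.exp (sqRate c * X ω ^ 2)) =
        ∫⁻ x, ENNReal.ofReal (Real.exp (X ω * x)) ∂γ := by
      intro ω
      rw [← ofReal_integral_eq_lintegral_ofReal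
        (integrable_exp_mul_gaussianReal _) (Filter.Eventually.of_forall fun x => by positivity)]
      have := congrFun (mgf_fun_id_gaussianReal (μ := 0) (v := 1 / (4 * (c + 1)))) (X ω)
      rw [mgf] at this
      rw [this]
      congr 2
      unfold sqRate
      push_cast
      have : (c : ℝ) + 1 ≠ 0 := by positivity
      field_simp
      ring
    simp_rw [h1]
    rw [lintegral_lintegral_swap (by fun_prop)]
    refine le_trans (lintegral_mono fun x => ?_) (lintegral_exp_sq_gaussian c)
    have h2 := h.integrable_exp_mul x
    simp_rw [mul_comm (X _) x]
    rw [← ofReal_integral_eq_lintegral_ofReal h2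
      (Filter.Eventually.of_forall fun x => by positivity)]
    apply ENNReal.ofReal_le_ofReal
    refine (h.mgf_le x).trans (le_of_eq ?_)
    congr 1
    push_cast
    ring
  have hint : Integrable (fun ω => Real.exp (sqRate c * X ω ^ 2)) P := by
    refine ⟨by fun_prop, ?_⟩
    rw [hasFiniteIntegral_iff_ofReal (Filter.Eventually.of_forall fun x => by positivity)]
    exact lt_of_le_of_lt key (by simp)
  refine ⟨hint, ?_⟩
  rw [integral_eq_lintegral_of_nonneg_ae (Filter.Eventually.of_forall fun x => by positivity)
    hint.1]
  exact ENNReal.toReal_le_of_le_ofReal (by norm_num) (by simpa using key)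

end

/-! ### Moments of linear forms and exponential bounds -/

section

variable {Ω ι : Type*} [MeasurableSpace Ω] {P : Measure Ω} {c : ℝ≥0} {κ : ℝ}

/-- The linear form `∑ a, u a * z a` in the variables `z`. -/
noncomputable def linForm [Fintype ι] (z : ι → Ω → ℝ) (u : ι → ℝ) (ω : Ω) : ℝ := ∑ a, u a * z a ω

section linear
variable [Fintype ι] {z : ι → Ω → ℝ}

lemma IsFactorVector.measurable_linForm (h : IsFactorVector P c κ z) (u : ι → ℝ) :
    Measurable (linForm z u) := by
  have := h.meas
  unfold linForm
  fun_prop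

lemma IsFactorVector.subgaussian_linForm (h : IsFactorVector P c κ z) {u : ι → ℝ}
    (hu : ∑ a, u a ^ 2 ≤ 1) : HasSubgaussianMGF (linForm z u) (2 * c) P := by
  have h1 := HasSubgaussianMGF.sum_of_iIndepFun (s := Finset.univ)
    (h.indep.comp (fun a x => u a * x) (fun a => by fun_prop))
    (fun a _ => (h.subgaussian a).const_mul (u a))
  refine ⟨h1.integrable_exp_mul, fun t => (h1.mgf_le t).trans ?_⟩
  apply Real.exp_le_exp.2
  have h2 : ((∑ a, (show ℝ≥0 from ⟨u a ^ 2, sq_nonneg _⟩) * (2 * c) : ℝ≥0) : ℝ) ≤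
      ((2 * c : ℝ≥0) : ℝ) := by
    rw [← Finset.sum_mul, NNReal.coe_mul, NNReal.coe_sum]
    exact mul_le_of_le_one_left (NNReal.coe_nonneg _) hu
  have h3 := sq_nonneg t
  have h4 := mul_le_mul_of_nonneg_right h2 h3
  linarith

lemma IsFactorVector.memLp_entry (h : IsFactorVector P c κ z) (a : ι) (p : ℝ≥0) :
    MemLp (z a) p P := (h.subgaussian a).memLp p

end linear

lemma integrable_pow_of_memLp [IsFiniteMeasure P] {X : Ω → ℝ} (h : ∀ p : ℝ≥0, MemLp X p P) (m : ℕ) :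
    Integrable (fun ω => X ω ^ m) P := by
  have h1 := (h m).integrable_norm_pow'
  refine Integrable.mono' h1 ((h m).1.pow m) (Filter.Eventually.of_forall fun ω => ?_)
  simp

/-- The second and fourth moments of a sum of independent centered variables. A vanishing third
moment of one summand is enough, so that summands can be added one at a time. -/
lemma moments_add [IsProbabilityMeasure P] {S Y : Ω → ℝ} (hS : ∀ p : ℝ≥0, MemLp S p P)
    (hY : ∀ p : ℝ≥0, MemLp Y p P) (hi : IndepFun S Y P) (hS1 : ∫ ω, S ω ∂P = 0)
    (hY1 : ∫ ω, Y ω ∂P = 0) (hY3 : ∫ ω, Y ω ^ 3 ∂P = 0) :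
    ∫ ω, (S ω + Y ω) ∂P = 0 ∧ ∫ ω, (S ω + Y ω) ^ 2 ∂P = ∫ ω, S ω ^ 2 ∂P + ∫ ω, Y ω ^ 2 ∂P ∧
    ∫ ω, (S ω + Y ω) ^ 4 ∂P = ∫ ω, S ω ^ 4 ∂P + 6 * (∫ ω, S ω ^ 2 ∂P) * (∫ ω, Y ω ^ 2 ∂P) +
      ∫ ω, Y ω ^ 4 ∂P := by
  have iS := integrable_pow_of_memLp hS
  have iY := integrable_pow_of_memLp hY
  have ind : ∀ i j : ℕ, IndepFun (fun ω => S ω ^ i) (fun ω => Y ω ^ j) P := fun i j =>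
    hi.comp (φ := fun x => x ^ i) (ψ := fun x => x ^ j) (by fun_prop) (by fun_prop)
  have iSY : ∀ i j : ℕ, Integrable (fun ω => S ω ^ i * Y ω ^ j) P := fun i j =>
    (ind i j).integrable_mul (iS i) (iY j)
  have eSY : ∀ i j : ℕ, ∫ ω, S ω ^ i * Y ω ^ j ∂P = (∫ ω, S ω ^ i ∂P) * ∫ ω, Y ω ^ j ∂P :=
    fun i j => (ind i j).integral_fun_mul_eq_mul_integral (iS i).1 (iY j).1
  refine ⟨?_, ?_, ?_⟩
  · have := integral_add (iS 1) (iY 1)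
    simp only [pow_one] at this
    rw [this, hS1, hY1, add_zero]
  · have : ∀ ω, (S ω + Y ω) ^ 2 = S ω ^ 2 + (2 * (S ω ^ 1 * Y ω ^ 1) + Y ω ^ 2) := fun ω => by ring
    simp_rw [this]
    have i1 : Integrable (fun ω => 2 * (S ω ^ 1 * Y ω ^ 1) + Y ω ^ 2) P :=
      ((iSY 1 1).const_mul 2).add (iY 2)
    rw [integral_add (iS 2) i1,
      integral_add ((iSY 1 1).const_mul 2) (iY 2), integral_const_mul, eSY]
    simp [hS1]
  · have : ∀ ω, (S ω + Y ω) ^ 4 = S ω ^ 4 + (4 * (S ω ^ 3 * Y ω ^ 1) + (6 * (S ω ^ 2 * Y ω ^ 2) +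
      (4 * (S ω ^ 1 * Y ω ^ 3) + Y ω ^ 4))) := fun ω => by ring
    simp_rw [this]
    have i1 : Integrable (fun ω => 4 * (S ω ^ 1 * Y ω ^ 3) + Y ω ^ 4) P :=
      ((iSY 1 3).const_mul 4).add (iY 4)
    have i2 : Integrable (fun ω => 6 * (S ω ^ 2 * Y ω ^ 2) +
        (4 * (S ω ^ 1 * Y ω ^ 3) + Y ω ^ 4)) P := ((iSY 2 2).const_mul 6).add i1
    have i3 : Integrable (fun ω => 4 * (S ω ^ 3 * Y ω ^ 1) + (6 * (S ω ^ 2 * Y ω ^ 2) +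
        (4 * (S ω ^ 1 * Y ω ^ 3) + Y ω ^ 4))) P := ((iSY 3 1).const_mul 4).add i2
    rw [integral_add (iS 4) i3, integral_add ((iSY 3 1).const_mul 4) i2,
      integral_add ((iSY 2 2).const_mul 6) i1, integral_add ((iSY 1 3).const_mul 4) (iY 4)]
    simp only [integral_const_mul, eSY]
    simp only [pow_one, hS1, hY1, hY3]
    ring

section linear
variable [Fintype ι] {z : ι → Ω → ℝ}

lemma IsFactorVector.memLp_linForm (h : IsFactorVector P c κ z) (u : ι → ℝ) (p : ℝ≥0) :
    MemLp (linForm z u) p P := by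
  unfold linForm
  exact memLp_finsetSum _ fun a _ => (h.memLp_entry a p).const_mul _

lemma IsFactorVector.moments_linForm_finset [IsProbabilityMeasure P] (h : IsFactorVector P c κ z)
    (u : ι → ℝ) (s : Finset ι) :
    ∫ ω, (∑ a ∈ s, u a * z a ω) ∂P = 0 ∧
    ∫ ω, (∑ a ∈ s, u a * z a ω) ^ 2 ∂P = ∑ a ∈ s, u a ^ 2 ∧
    ∫ ω, (∑ a ∈ s, u a * z a ω) ^ 4 ∂P =
      3 * (∑ a ∈ s, u a ^ 2) ^ 2 + (κ - 3) * ∑ a ∈ s, u a ^ 4 := by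
  classical
  induction s using Finset.induction_on with
  | empty => simp
  | insert b s hb ih =>
    obtain ⟨h1, h2, h4⟩ := ih
    have hS : ∀ p : ℝ≥0, MemLp (fun ω => ∑ a ∈ s, u a * z a ω) p P := fun p =>
      memLp_finsetSum _ fun a _ => (h.memLp_entry a p).const_mul _
    have hY : ∀ p : ℝ≥0, MemLp (fun ω => u b * z b ω) p P := fun p =>
      (h.memLp_entry b p).const_mul _
    have hi : IndepFun (fun ω => ∑ a ∈ s, u a * z a ω) (fun ω => u b * z b ω) P := by
      have := (h.indep.comp (fun a x => u a * x)
        (fun a => by fun_prop)).indepFun_finsetSum_of_notMem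
        (fun a => by have := h.meas a; simp only [Function.comp_def]; fun_prop) hb
      convert this using 1
      · ext ω
        simp
      · rfl
    have e : ∀ m : ℕ, ∫ ω, (u b * z b ω) ^ m ∂P = u b ^ m * ∫ ω, z b ω ^ m ∂P := fun m => by
      simp_rw [mul_pow]; rw [integral_const_mul]
    have e1 : ∫ ω, u b * z b ω ∂P = 0 := by rw [integral_const_mul, h.moment_one, mul_zero]
    obtain ⟨r1, r2, r4⟩ := moments_add hS hY hi h1 e1 (by rw [e, h.moment_three, mul_zero])
    simp_rw [Finset.sum_insert hb, add_comm (u b * z b _)]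
    refine ⟨r1, ?_, ?_⟩
    · rw [r2, h2, e, h.moment_two]; ring
    · rw [r4, h2, h4, e, e, h.moment_two, h.moment_four]; ring

lemma IsFactorVector.integral_linForm_sq [IsProbabilityMeasure P] (h : IsFactorVector P c κ z)
    (u : ι → ℝ) : ∫ ω, linForm z u ω ^ 2 ∂P = ∑ a, u a ^ 2 :=
  (h.moments_linForm_finset u Finset.univ).2.1

lemma IsFactorVector.integral_linForm_pow_four [IsProbabilityMeasure P]
    (h : IsFactorVector P c κ z) (u : ι → ℝ) :
    ∫ ω, linForm z u ω ^ 4 ∂P = 3 * (∑ a, u a ^ 2) ^ 2 + (κ - 3) * ∑ a, u a ^ 4 :=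
  (h.moments_linForm_finset u Finset.univ).2.2

end linear

/-- Chernoff's bound for a sum of independent variables with a common bound on the
moment generating function. -/
lemma chernoff_sum [Fintype ι] [IsProbabilityMeasure P] {Y : ι → Ω → ℝ}
    (hm : ∀ i, Measurable (Y i)) (hi : iIndepFun Y P) {l b : ℝ} (hl : 0 ≤ l)
    (hint : ∀ i, Integrable (fun ω => Real.exp (l * Y i ω)) P)
    (hb : ∀ i, ∫ ω, Real.exp (l * Y i ω) ∂P ≤ Real.exp b) (s : ℝ) :
    P.real {ω | s ≤ ∑ i, Y i ω} ≤ Real.exp (-l * s + Fintype.card ι * b) := by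
  have h1 := measure_ge_le_exp_mul_mgf (μ := P) (X := ∑ i, Y i) (t := l) s hl
    (by simpa using hi.integrable_exp_mul_sum hm (s := Finset.univ) (fun i _ => hint i))
  simp only [Finset.sum_apply] at h1
  refine h1.trans ?_
  rw [hi.mgf_sum hm, Real.exp_add]
  gcongr
  calc ∏ i, mgf (Y i) P l ≤ ∏ _i : ι, Real.exp b :=
        Finset.prod_le_prod (fun i _ => mgf_nonneg) fun i _ => hb i
    _ = _ := by rw [Finset.prod_const, ← Real.exp_nat_mul, Finset.card_univ]

section tails
variable {X : Ω → ℝ} {a : ℝ}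

/-- Bound on the eighth moment of variables with `E exp (a X ^ 2) ≤ 2`. -/
noncomputable def eighthBound (a : ℝ) : ℝ := 48 / a ^ 4

lemma pow_eight_le_exp_sq (ha : 0 < a) (x : ℝ) : x ^ 8 ≤ 24 / a ^ 4 * Real.exp (a * x ^ 2) := by
  have := Real.pow_div_factorial_le_exp (a * x ^ 2) (by positivity) 4
  rw [div_mul_eq_mul_div, le_div_iff₀ (by positivity)]
  simp only [Nat.factorial] at this
  push_cast at this
  rw [div_le_iff₀ (by positivity)] at this
  nlinarith

lemma integral_pow_eight_le (hX : Measurable X) (ha : 0 < a)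
    (hI : Integrable (fun ω => Real.exp (a * X ω ^ 2)) P)
    (hE : ∫ ω, Real.exp (a * X ω ^ 2) ∂P ≤ 2) :
    Integrable (fun ω => X ω ^ 8) P ∧ ∫ ω, X ω ^ 8 ∂P ≤ eighthBound a := by
  have hb := fun ω => pow_eight_le_exp_sq ha (X ω)
  have hint : Integrable (fun ω => X ω ^ 8) P :=
    Integrable.mono' (hI.const_mul (24 / a ^ 4)) (by fun_prop)
      (Filter.Eventually.of_forall fun ω => by
        rw [Real.norm_of_nonneg (by positivity)]; exact hb ω)
  refine ⟨hint, (integral_mono hint (hI.const_mul _) hb).trans ?_⟩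
  rw [integral_const_mul, eighthBound, show (48 : ℝ) / a ^ 4 = 24 / a ^ 4 * 2 by ring]
  gcongr

variable [IsProbabilityMeasure P]

/-- For a bounded nonnegative variable, `exp y ≤ 1 + y + y ^ 2` on `[0, 1]` gives a moment
generating function of Bernstein type. -/
lemma mgf_truncated_le (hX : Measurable X) (ha : 0 < a)
    (hI : Integrable (fun ω => Real.exp (a * X ω ^ 2)) P)
    (hE : ∫ ω, Real.exp (a * X ω ^ 2) ∂P ≤ 2) {b l m : ℝ} (hb : 0 ≤ b) (hl : 0 ≤ l)
    (hlb : l * b ≤ 1) (h4 : Integrable (fun ω => X ω ^ 4) P) (hm : ∫ ω, X ω ^ 4 ∂P ≤ m) :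
    Integrable (fun ω => Real.exp (l * min (X ω ^ 4) b)) P ∧
    ∫ ω, Real.exp (l * min (X ω ^ 4) b) ∂P ≤ Real.exp (l * m + l ^ 2 * eighthBound a) := by
  obtain ⟨i8, e8⟩ := integral_pow_eight_le hX ha hI hE
  have hpt : ∀ ω, Real.exp (l * min (X ω ^ 4) b) ≤ 1 + (l * X ω ^ 4 + l ^ 2 * X ω ^ 8) := by
    intro ω
    set w := min (X ω ^ 4) b
    have hw0 : 0 ≤ w := le_min (by positivity) hb
    have hw1 : w ≤ X ω ^ 4 := min_le_left _ _
    have hy : l * w ≤ 1 := (mul_le_mul_of_nonneg_left (min_le_right _ _) hl).trans hlb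
    have hy0 : 0 ≤ l * w := by positivity
    have := Real.abs_exp_sub_one_sub_id_le (x := l * w) (by rwa [abs_of_nonneg hy0])
    have h2 := (abs_le.1 this).2
    have h3 : (l * w) ^ 2 ≤ l ^ 2 * X ω ^ 8 := by
      rw [mul_pow, show X ω ^ 8 = (X ω ^ 4) ^ 2 by ring]
      gcongr
    have h4 : l * w ≤ l * X ω ^ 4 := by gcongr
    linarith
  have irhs : Integrable (fun ω => 1 + (l * X ω ^ 4 + l ^ 2 * X ω ^ 8)) P :=
    (integrable_const _).add ((h4.const_mul _).add (i8.const_mul _))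
  have ilhs : Integrable (fun ω => Real.exp (l * min (X ω ^ 4) b)) P :=
    Integrable.mono' irhs (by fun_prop) (Filter.Eventually.of_forall fun ω => by
        rw [Real.norm_of_nonneg (by positivity)]; exact hpt ω)
  refine ⟨ilhs, (integral_mono ilhs irhs hpt).trans ?_⟩
  have i2 : Integrable (fun ω => l * X ω ^ 4 + l ^ 2 * X ω ^ 8) P :=
    (h4.const_mul _).add (i8.const_mul _)
  rw [integral_add (integrable_const _) i2,
    integral_add (h4.const_mul _) (i8.const_mul _), integral_const_mul, integral_const_mul]
  simp only [integral_const, probReal_univ, smul_eq_mul, mul_one]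
  have h1 : l * ∫ ω, X ω ^ 4 ∂P ≤ l * m := by gcongr
  have h2 : l ^ 2 * ∫ ω, X ω ^ 8 ∂P ≤ l ^ 2 * eighthBound a := by gcongr
  have := Real.add_one_le_exp (l * m + l ^ 2 * eighthBound a)
  linarith

/-- Large values of the square: on `{X ^ 2 > B}` half of the exponential moment is traded for the
factor `exp (-a B / 2)`. -/
lemma mgf_excess_le (hX : Measurable X) (ha : 0 < a)
    (hI : Integrable (fun ω => Real.exp (a * X ω ^ 2)) P)
    (hE : ∫ ω, Real.exp (a * X ω ^ 2) ∂P ≤ 2) (B : ℝ) :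
    Integrable (fun ω => Real.exp (a / 2 * (if B < X ω ^ 2 then X ω ^ 2 else 0))) P ∧
    ∫ ω, Real.exp (a / 2 * (if B < X ω ^ 2 then X ω ^ 2 else 0)) ∂P ≤
      Real.exp (2 * Real.exp (-(a * B / 2))) := by
  have hpt : ∀ ω, Real.exp (a / 2 * (if B < X ω ^ 2 then X ω ^ 2 else 0)) ≤
      1 + Real.exp (-(a * B / 2)) * Real.exp (a * X ω ^ 2) := by
    intro ω
    split_ifs with h
    · rw [← Real.exp_add]
      have : Real.exp (a / 2 * X ω ^ 2) ≤ Real.exp (-(a * B / 2) + a * X ω ^ 2) := by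
        apply Real.exp_le_exp.2
        nlinarith
      linarith
    · simp; positivity
  have hm : Measurable fun ω => (if B < X ω ^ 2 then X ω ^ 2 else 0) :=
    Measurable.ite (measurableSet_lt measurable_const (by fun_prop)) (by fun_prop) measurable_const
  have irhs : Integrable (fun ω => 1 + Real.exp (-(a * B / 2)) * Real.exp (a * X ω ^ 2)) P :=
    (integrable_const _).add (hI.const_mul _)
  have ilhs : Integrable (fun ω => Real.exp (a / 2 * (if B < X ω ^ 2 then X ω ^ 2 else 0))) P :=
    Integrable.mono' irhs (by fun_prop) (Filter.Eventually.of_forall fun ω => by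
        rw [Real.norm_of_nonneg (by positivity)]; exact hpt ω)
  refine ⟨ilhs, (integral_mono ilhs irhs hpt).trans ?_⟩
  rw [integral_add (integrable_const _) (hI.const_mul _), integral_const_mul]
  simp only [integral_const, probReal_univ, smul_eq_mul, mul_one]
  have h1 : Real.exp (-(a * B / 2)) * ∫ ω, Real.exp (a * X ω ^ 2) ∂P ≤
    Real.exp (-(a * B / 2)) * 2 := by gcongr
  have := Real.add_one_le_exp (2 * Real.exp (-(a * B / 2)))
  linarith

/-- For `l` well below `a`, the moment generating function of `X ^ 2` at `l` is
`1 + l E X ^ 2 + O(l ^ 2)`. -/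
lemma mgf_sq_le (hX : Measurable X) (ha : 0 < a)
    (hI : Integrable (fun ω => Real.exp (a * X ω ^ 2)) P)
    (hE : ∫ ω, Real.exp (a * X ω ^ 2) ∂P ≤ 2) {l : ℝ} (hl : 0 ≤ l) (hla : l ≤ a / 2)
    (h2 : Integrable (fun ω => X ω ^ 2) P) (hm : ∫ ω, X ω ^ 2 ∂P ≤ 1) :
    Integrable (fun ω => Real.exp (l * X ω ^ 2)) P ∧
    ∫ ω, Real.exp (l * X ω ^ 2) ∂P ≤ Real.exp (l + 16 * l ^ 2 / a ^ 2) := by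
  have hpt : ∀ ω, Real.exp (l * X ω ^ 2) ≤
      1 + (l * X ω ^ 2 + 8 * l ^ 2 / a ^ 2 * Real.exp (a * X ω ^ 2)) := by
    intro ω
    set q := X ω ^ 2
    have hq : 0 ≤ q := sq_nonneg _
    have e1 : Real.exp (l * q) ≤ 1 + l * q + (l * q) ^ 2 * Real.exp (l * q) := by
      have hy : 0 ≤ l * q := by positivity
      generalize l * q = y at hy
      have h4 := Real.one_sub_le_exp_neg y
      have h5 := Real.exp_pos y
      have h6 : Real.exp y * Real.exp (-y) = 1 := by rw [← Real.exp_add]; simp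
      have h7 : Real.exp y ≤ 1 + y * Real.exp y := by nlinarith
      nlinarith
    have e2 : q ^ 2 ≤ 8 / a ^ 2 * Real.exp (a * q / 2) := by
      have := Real.pow_div_factorial_le_exp (a * q / 2) (by positivity) 2
      simp only [Nat.factorial] at this
      push_cast at this
      rw [div_mul_eq_mul_div, le_div_iff₀ (by positivity)]
      nlinarith
    have e3 : Real.exp (l * q) ≤ Real.exp (a * q / 2) := by
      apply Real.exp_le_exp.2; nlinarith
    have e4 : Real.exp (a * q) = Real.exp (a * q / 2) * Real.exp (a * q / 2) := by
      rw [← Real.exp_add]; ring_nf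
    have e5 : (l * q) ^ 2 * Real.exp (l * q) ≤
        l ^ 2 * (8 / a ^ 2 * Real.exp (a * q / 2)) * Real.exp (a * q / 2) := by
      rw [mul_pow]
      gcongr
    have e6 : l ^ 2 * (8 / a ^ 2 * Real.exp (a * q / 2)) * Real.exp (a * q / 2) =
        8 * l ^ 2 / a ^ 2 * Real.exp (a * q) := by rw [e4]; ring
    linarith
  have irhs : Integrable (fun ω => 1 + (l * X ω ^ 2 + 8 * l ^ 2 / a ^ 2 *
      Real.exp (a * X ω ^ 2))) P :=
    (integrable_const _).add ((h2.const_mul _).add (hI.const_mul _))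
  have ilhs : Integrable (fun ω => Real.exp (l * X ω ^ 2)) P :=
    Integrable.mono' irhs (by fun_prop) (Filter.Eventually.of_forall fun ω => by
        rw [Real.norm_of_nonneg (by positivity)]; exact hpt ω)
  refine ⟨ilhs, (integral_mono ilhs irhs hpt).trans ?_⟩
  have i2 : Integrable (fun ω => l * X ω ^ 2 + 8 * l ^ 2 / a ^ 2 * Real.exp (a * X ω ^ 2)) P :=
    (h2.const_mul _).add (hI.const_mul _)
  rw [integral_add (integrable_const _) i2,
    integral_add (h2.const_mul _) (hI.const_mul _), integral_const_mul, integral_const_mul]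
  simp only [integral_const, probReal_univ, smul_eq_mul, mul_one]
  have h1 : l * ∫ ω, X ω ^ 2 ∂P ≤ l * 1 := by gcongr
  have h2 : 8 * l ^ 2 / a ^ 2 * ∫ ω, Real.exp (a * X ω ^ 2) ∂P ≤ 8 * l ^ 2 / a ^ 2 * 2 := by gcongr
  have := Real.add_one_le_exp (l + 16 * l ^ 2 / a ^ 2)
  have e : 8 * l ^ 2 / a ^ 2 * 2 = 16 * l ^ 2 / a ^ 2 := by ring
  linarith

end tails

end

/-! ### Tail bounds for sums over rows, and the grid -/

section

variable {Ω ι : Type*} [MeasurableSpace Ω] {P : Measure Ω} {c : ℝ≥0} {κ : ℝ}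

section rows
variable {α β : Type*} [Fintype α] [Fintype β] {z : α × β → Ω → ℝ}

/-- The linear form with coefficients `u` in the `i`-th row of the array `z`. -/
noncomputable def rowForm (z : α × β → Ω → ℝ) (u : β → ℝ) (i : α) : Ω → ℝ :=
  linForm (fun j => z (i, j)) u

lemma IsFactorVector.row (h : IsFactorVector P c κ z) (i : α) :
    IsFactorVector P c κ (fun j => z (i, j)) :=
  h.comp_injective (g := fun j => (i, j)) (Prod.mk_right_injective i)

lemma IsFactorVector.measurable_rowForm (h : IsFactorVector P c κ z) (u : β → ℝ) (i : α) :
    Measurable (rowForm z u i) := (h.row i).measurable_linForm u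

lemma IsFactorVector.iIndepFun_rowForm (h : IsFactorVector P c κ z) (u : β → ℝ) :
    iIndepFun (rowForm z u) P :=
  (iIndepFun_rows h.meas h.indep).comp (fun _ x => ∑ j, u j * x j) (fun _ => by fun_prop)

variable [IsProbabilityMeasure P]

lemma IsFactorVector.exp_sq_rowForm (h : IsFactorVector P c κ z) {u : β → ℝ}
    (hu : ∑ j, u j ^ 2 ≤ 1) (i : α) :
    Integrable (fun ω => Real.exp (sqRate c * rowForm z u i ω ^ 2)) P ∧
      ∫ ω, Real.exp (sqRate c * rowForm z u i ω ^ 2) ∂P ≤ 2 :=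
  exp_sq_of_subgaussian (h.measurable_rowForm u i) ((h.row i).subgaussian_linForm hu)

lemma IsFactorVector.integrable_rowForm_pow (h : IsFactorVector P c κ z) (u : β → ℝ) (i : α)
    (m : ℕ) : Integrable (fun ω => rowForm z u i ω ^ m) P :=
  integrable_pow_of_memLp (fun p => (h.row i).memLp_linForm u p) m

lemma IsFactorVector.integral_rowForm_pow_four_le (h : IsFactorVector P c κ z) {u : β → ℝ}
    (hu : ∑ j, u j ^ 2 ≤ 1) (i : α) :
    ∫ ω, rowForm z u i ω ^ 4 ∂P ≤ 3 + (κ - 3) * ∑ j, u j ^ 4 := by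
  have := (h.row i).integral_linForm_pow_four u
  unfold rowForm
  rw [this]
  have h0 : 0 ≤ ∑ j, u j ^ 2 := Finset.sum_nonneg fun j _ => sq_nonneg _
  nlinarith

/-- Upper tail of the truncated fourth powers of the linear forms. -/
lemma IsFactorVector.prob_truncated_le (h : IsFactorVector P c κ z) {u : β → ℝ}
    (hu : ∑ j, u j ^ 2 ≤ 1) {b l m : ℝ} (hb : 0 ≤ b) (hl : 0 ≤ l) (hlb : l * b ≤ 1)
    (hm : 3 + (κ - 3) * ∑ j, u j ^ 4 ≤ m) (s : ℝ) :
    P.real {ω | s ≤ ∑ i, min (rowForm z u i ω ^ 4) b} ≤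
      Real.exp (-l * s + Fintype.card α * (l * m + l ^ 2 * eighthBound (sqRate c))) := by
  have hmgf := fun i => mgf_truncated_le (h.measurable_rowForm u i) (sqRate_pos c)
    (h.exp_sq_rowForm hu i).1 (h.exp_sq_rowForm hu i).2 hb hl hlb (h.integrable_rowForm_pow u i 4)
    ((h.integral_rowForm_pow_four_le hu i).trans hm)
  refine chernoff_sum (fun i => ?_)
    ((h.iIndepFun_rowForm u).comp (fun _ x => min (x ^ 4) b) (fun _ => by fun_prop)) hl
    (fun i => (hmgf i).1) (fun i => (hmgf i).2) s
  have := h.measurable_rowForm u i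
  simp only [Function.comp_def]
  fun_prop

/-- Upper tail of the squares of the large values of the linear forms. -/
lemma IsFactorVector.prob_excess_le (h : IsFactorVector P c κ z) {u : β → ℝ}
    (hu : ∑ j, u j ^ 2 ≤ 1) (B s : ℝ) :
    P.real {ω | s ≤ ∑ i, if B < rowForm z u i ω ^ 2 then rowForm z u i ω ^ 2 else 0} ≤
      Real.exp (-(sqRate c / 2) * s + Fintype.card α * (2 * Real.exp (-(sqRate c * B / 2)))) := by
  have hmgf := fun i => mgf_excess_le (h.measurable_rowForm u i) (sqRate_pos c)
    (h.exp_sq_rowForm hu i).1 (h.exp_sq_rowForm hu i).2 B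
  have hg : Measurable fun x : ℝ => if B < x ^ 2 then x ^ 2 else 0 :=
    Measurable.ite (measurableSet_lt measurable_const (by fun_prop)) (by fun_prop) measurable_const
  have ha := sqRate_pos c
  exact chernoff_sum (fun i => hg.comp (h.measurable_rowForm u i))
    ((h.iIndepFun_rowForm u).comp (fun _ x => if B < x ^ 2 then x ^ 2 else 0) (fun _ => hg))
    (by positivity) (fun i => (hmgf i).1) (fun i => (hmgf i).2) s

/-- Upper tail of the sum of the squares of the linear forms. -/
lemma IsFactorVector.prob_sq_le (h : IsFactorVector P c κ z) {u : β → ℝ}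
    (hu : ∑ j, u j ^ 2 ≤ 1) {l : ℝ} (hl : 0 ≤ l) (hla : l ≤ sqRate c / 2) (s : ℝ) :
    P.real {ω | s ≤ ∑ i, rowForm z u i ω ^ 2} ≤
      Real.exp (-l * s + Fintype.card α * (l + 16 * l ^ 2 / sqRate c ^ 2)) := by
  have hmgf := fun i => mgf_sq_le (h.measurable_rowForm u i) (sqRate_pos c)
    (h.exp_sq_rowForm hu i).1 (h.exp_sq_rowForm hu i).2 hl hla (h.integrable_rowForm_pow u i 2)
    (((h.row i).integral_linForm_sq u).trans_le hu)
  refine chernoff_sum (fun i => ?_)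
    ((h.iIndepFun_rowForm u).comp (fun _ x => x ^ 2) (fun _ => by fun_prop)) hl
    (fun i => (hmgf i).1) (fun i => (hmgf i).2) s
  have := h.measurable_rowForm u i
  simp only [Function.comp_def]
  fun_prop

/-- Splitting `x ^ 4 ≤ min (x ^ 4) (B ^ 2) + (x ^ 2 1{x ^ 2 > B}) ^ 2` bounds the upper tail of the
sum of the fourth powers by that of a bounded sum and that of a sum with exponential moments. -/
lemma IsFactorVector.prob_pow_four_le (h : IsFactorVector P c κ z) {u : β → ℝ}
    (hu : ∑ j, u j ^ 2 ≤ 1) {B l m s t : ℝ} (hl : 0 ≤ l) (hB : 0 ≤ B)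
    (hlB : l * B ^ 2 ≤ 1) (hm : 3 + (κ - 3) * ∑ j, u j ^ 4 ≤ m) :
    P.real {ω | s + t ^ 2 ≤ ∑ i, rowForm z u i ω ^ 4} ≤
      Real.exp (-l * s + Fintype.card α * (l * m + l ^ 2 * eighthBound (sqRate c))) +
      Real.exp (-(sqRate c / 2) * t +
        Fintype.card α * (2 * Real.exp (-(sqRate c * B / 2)))) := by
  refine le_trans ?_ (add_le_add (h.prob_truncated_le hu (sq_nonneg B) hl hlB hm s)
    (h.prob_excess_le hu B t))
  refine le_trans (measureReal_mono ?_ (measure_ne_top _ _)) (measureReal_union_le _ _)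
  intro ω hω
  simp only [Set.mem_ofPred_eq, Set.mem_union] at hω ⊢
  by_contra hcon
  push Not at hcon
  obtain ⟨h1, h2⟩ := hcon
  set X := fun i => rowForm z u i ω
  have h3 : ∑ i, X i ^ 4 ≤ ∑ i, min (X i ^ 4) (B ^ 2) +
      (∑ i, if B < X i ^ 2 then X i ^ 2 else 0) ^ 2 := by
    have h0 : ∀ i, 0 ≤ if B < X i ^ 2 then X i ^ 2 else 0 := fun i => by split_ifs <;> positivity
    have h5 : ∑ i, (if B < X i ^ 2 then X i ^ 2 else 0) ^ 2 ≤
        (∑ i, if B < X i ^ 2 then X i ^ 2 else 0) ^ 2 :=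
      Finset.sum_sq_le_sq_sum_of_nonneg fun i _ => h0 i
    refine le_trans ?_ (add_le_add_right h5 _)
    rw [← Finset.sum_add_distrib]
    refine Finset.sum_le_sum fun i _ => ?_
    split_ifs with hi
    · have : 0 ≤ min (X i ^ 4) (B ^ 2) := le_min (by positivity) (by positivity)
      nlinarith
    · rw [min_eq_left (by nlinarith [sq_nonneg (X i)])]
      simp
  have h0 : 0 ≤ ∑ i, if B < X i ^ 2 then X i ^ 2 else 0 :=
    Finset.sum_nonneg fun i _ => by split_ifs <;> positivity
  have h4 : (∑ i, if B < X i ^ 2 then X i ^ 2 else 0) ^ 2 ≤ t ^ 2 := by gcongr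
  simp only [X] at *
  linarith

end rows

section entries
variable [Fintype ι] {z : ι → Ω → ℝ} [IsProbabilityMeasure P]

lemma IsFactorVector.integral_pow_eight_le (h : IsFactorVector P c κ z) (a : ι) :
    ∫ ω, z a ω ^ 8 ∂P ≤ eighthBound (sqRate c) :=
  (VarimaxRotation.integral_pow_eight_le (h.meas a) (sqRate_pos c)
    (exp_sq_of_subgaussian (h.meas a) (h.subgaussian a)).1
    (exp_sq_of_subgaussian (h.meas a) (h.subgaussian a)).2).2

/-- Chebyshev's inequality for the sum of the fourth powers of the entries. -/
lemma IsFactorVector.prob_sum_pow_four (h : IsFactorVector P c κ z) {t : ℝ} (ht : 0 < t) :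
    P.real {ω | t ≤ |∑ a, z a ω ^ 4 - Fintype.card ι * κ|} ≤
      Fintype.card ι * eighthBound (sqRate c) / t ^ 2 := by
  have hmem : ∀ a, MemLp (fun ω => z a ω ^ 4) 2 P := fun a => by
    rw [memLp_two_iff_integrable_sq (by have := h.meas a; fun_prop)]
    simp_rw [← pow_mul]
    exact integrable_pow_of_memLp (h.memLp_entry a) _
  have hvar : ∀ a, variance (fun ω => z a ω ^ 4) P ≤ eighthBound (sqRate c) := fun a => by
    refine (variance_le_expectation_sq (hmem a).1).trans ?_
    simp only [Pi.pow_apply, ← pow_mul]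
    exact h.integral_pow_eight_le a
  have hsum : MemLp (∑ a, fun ω => z a ω ^ 4) 2 P := memLp_finsetSum' _ fun a _ => hmem a
  have hmean : ∫ ω, (∑ a, fun ω => z a ω ^ 4) ω ∂P = Fintype.card ι * κ := by
    simp only [Finset.sum_apply]
    rw [integral_finsetSum _ fun a _ => (hmem a).integrable (by norm_num)]
    simp [h.moment_four]
  have hv : variance (∑ a, fun ω => z a ω ^ 4) P ≤ Fintype.card ι * eighthBound (sqRate c) := by
    rw [IndepFun.variance_sum (fun a _ => hmem a)]
    · calc _ ≤ ∑ _a : ι, eighthBound (sqRate c) := Finset.sum_le_sum fun a _ => hvar a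
        _ = _ := by simp
    · intro a _ b _ hab
      exact (h.indep.indepFun hab).comp (φ := fun x => x ^ 4) (ψ := fun x => x ^ 4)
        (by fun_prop) (by fun_prop)
  have key := meas_ge_le_variance_div_sq hsum ht
  rw [hmean] at key
  simp only [Finset.sum_apply] at key
  refine ENNReal.toReal_le_of_le_ofReal ?_ (key.trans (ENNReal.ofReal_le_ofReal ?_))
  · have : 0 ≤ eighthBound (sqRate c) := by unfold eighthBound; positivity
    positivity
  · gcongr

/-- All entries are bounded by `T` except on an event of small probability. -/
lemma IsFactorVector.prob_exists_large (h : IsFactorVector P c κ z) {T : ℝ} (hT : 0 < T) :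
    P.real {ω | ∃ a, T < |z a ω|} ≤ Fintype.card ι * κ / T ^ 4 := by
  have h1 : {ω | ∃ a, T < |z a ω|} ⊆ {ω | T ^ 4 ≤ ∑ a, z a ω ^ 4} := by
    rintro ω ⟨a, ha⟩
    have h2 : T ^ 4 ≤ z a ω ^ 4 := by
      rw [← (show Even 4 by decide).pow_abs (z a ω)]
      gcongr
    exact h2.trans (Finset.single_le_sum (f := fun a => z a ω ^ 4)
      (fun a _ => by positivity) (Finset.mem_univ a))
  have hint : ∀ a, Integrable (fun ω => z a ω ^ 4) P := fun a =>
    integrable_pow_of_memLp (h.memLp_entry a) _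
  have h3 := mul_meas_ge_le_integral_of_nonneg (μ := P) (f := fun ω => ∑ a, z a ω ^ 4)
    (Filter.Eventually.of_forall fun ω => Finset.sum_nonneg fun a _ => by positivity)
    (integrable_finsetSum _ fun a _ => hint a) (T ^ 4)
  rw [integral_finsetSum _ fun a _ => hint a] at h3
  simp only [h.moment_four, Finset.sum_const, Finset.card_univ, nsmul_eq_mul] at h3
  rw [le_div_iff₀ (by positivity), mul_comm]
  refine le_trans ?_ h3
  gcongr
  exact measure_ne_top _ _

end entries

section grid
variable [Fintype ι] [DecidableEq ι]

/-- The vectors supported in `I` with coordinates in `{-1, …, -1/M, 0, 1/M, …, 1}`. -/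
noncomputable def gridVectors (M : ℕ) (I : Finset ι) : Finset (ι → ℝ) :=
  (Fintype.piFinset fun i : ι => if i ∈ I then Finset.Icc (-(M : ℤ)) M else {0}).image
    fun g i => (g i : ℝ) / M

lemma card_gridVectors_le (M : ℕ) (I : Finset ι) :
    (gridVectors M I).card ≤ (2 * M + 1) ^ I.card := by
  refine Finset.card_image_le.trans ?_
  rw [Fintype.card_piFinset]
  have : ∀ i, (if i ∈ I then Finset.Icc (-(M : ℤ)) M else {0}).card =
      if i ∈ I then 2 * M + 1 else 1 := fun i => by
    split_ifs
    · rw [Int.card_Icc]; omega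
    · simp
  simp_rw [this]
  rw [Finset.prod_ite_mem]
  simp

/-- Rounding the coordinates toward zero moves a vector to a nearby grid vector with smaller
coordinates. -/
lemma exists_gridVector {M : ℕ} (hM : 0 < M) {I : Finset ι} {u : ι → ℝ} (hu : ∀ i, |u i| ≤ 1)
    (hI : ∀ i ∉ I, u i = 0) :
    ∃ v ∈ gridVectors M I, ∀ i, |v i| ≤ |u i| ∧ |u i - v i| ≤ 1 / M := by
  have hM' : (0 : ℝ) < M := by exact_mod_cast hM
  have key : ∀ x : ℝ, |x| ≤ 1 → ∃ m : ℤ, (-(M : ℤ) ≤ m ∧ m ≤ M) ∧ (x = 0 → m = 0) ∧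
      |(m : ℝ) / M| ≤ |x| ∧ |x - m / M| ≤ 1 / M := by
    have pos : ∀ x : ℝ, 0 ≤ x → x ≤ 1 → ∃ m : ℤ, (0 ≤ m ∧ m ≤ M) ∧ (x = 0 → m = 0) ∧
        (m : ℝ) / M ≤ x ∧ x - m / M ≤ 1 / M := by
      intro x hx hx1
      have h1 := Int.floor_le (x * M)
      have h2 := (Int.lt_floor_add_one (x * M)).le
      refine ⟨⌊x * M⌋, ⟨Int.floor_nonneg.2 (by positivity), ?_⟩, ?_, ?_, ?_⟩
      · have : (⌊x * M⌋ : ℝ) ≤ M := by nlinarith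
        exact_mod_cast this
      · rintro rfl; simp
      · rwa [div_le_iff₀ hM']
      · rw [sub_le_iff_le_add, ← add_div, le_div_iff₀ hM']
        linarith
    intro x hx
    rcases le_total 0 x with h | h
    · obtain ⟨m, ⟨h0, h1⟩, h2, h3, h4⟩ := pos x h (by rwa [abs_of_nonneg h] at hx)
      have hm : (0 : ℝ) ≤ m / M := div_nonneg (by exact_mod_cast h0) hM'.le
      refine ⟨m, ⟨by omega, h1⟩, h2, ?_, ?_⟩
      · rwa [abs_of_nonneg hm, abs_of_nonneg h]
      · rwa [abs_of_nonneg (by linarith)]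
    · obtain ⟨m, ⟨h0, h1⟩, h2, h3, h4⟩ := pos (-x) (by linarith) (by rwa [abs_of_nonpos h] at hx)
      have hm : (0 : ℝ) ≤ m / M := div_nonneg (by exact_mod_cast h0) hM'.le
      have e : ((-m : ℤ) : ℝ) / M = -(m / M) := by push_cast; ring
      refine ⟨-m, ⟨by omega, by omega⟩, fun hx0 => by rw [h2 (by rw [hx0, neg_zero]), neg_zero],
        ?_, ?_⟩
      · rwa [e, abs_neg, abs_of_nonneg hm, abs_of_nonpos h]
      · rw [e, abs_of_nonpos (by linarith)]
        linarith
  choose! m hm using key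
  refine ⟨fun i => (m (u i) : ℝ) / M, ?_, fun i => (hm (u i) (hu i)).2.2⟩
  refine Finset.mem_image.2 ⟨fun i => m (u i), ?_, rfl⟩
  rw [Fintype.mem_piFinset]
  intro i
  split_ifs with hi
  · exact Finset.mem_Icc.2 (hm (u i) (hu i)).1
  · exact Finset.mem_singleton.2 ((hm (u i) (hu i)).2.1 (hI i hi))

end grid

lemma measureReal_biUnion_le_card_mul [IsFiniteMeasure P] {γ : Type*} (S : Finset γ)
    (A : γ → Set Ω) {p : ℝ} (hp : ∀ g ∈ S, P.real (A g) ≤ p) :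
    P.real (⋃ g ∈ S, A g) ≤ S.card * p := by
  refine (measureReal_biUnion_finset_le S A).trans ?_
  calc _ ≤ ∑ _g ∈ S, p := Finset.sum_le_sum hp
    _ = _ := by simp

end

/-! ### Orthogonal matrices near signed permutations -/

section orthogonal
variable {k : ℕ} {V : Matrix (Fin k) (Fin k) ℝ}

lemma sum_row_sq (hV : V ∈ Matrix.orthogonalGroup (Fin k) ℝ) (j : Fin k) :
    ∑ l, V j l ^ 2 = 1 := by
  have h := congrFun (congrFun ((Matrix.mem_orthogonalGroup_iff (Fin k) ℝ).1 hV) j) j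
  simp only [Matrix.mul_apply, Matrix.transpose_apply, Matrix.one_apply_eq] at h
  simpa only [sq] using h

lemma sum_col_sq (hV : V ∈ Matrix.orthogonalGroup (Fin k) ℝ) (l : Fin k) :
    ∑ j, V j l ^ 2 = 1 := by
  have h := congrFun (congrFun ((Matrix.mem_orthogonalGroup_iff' (Fin k) ℝ).1 hV) l) l
  simp only [Matrix.mul_apply, Matrix.transpose_apply, Matrix.one_apply_eq] at h
  simpa only [sq] using h

lemma transpose_mem_orthogonalGroup (hV : V ∈ Matrix.orthogonalGroup (Fin k) ℝ) :
    Vᵀ ∈ Matrix.orthogonalGroup (Fin k) ℝ := by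
  have := (Matrix.mem_orthogonalGroup_iff' (Fin k) ℝ).1 hV
  rw [Matrix.mem_orthogonalGroup_iff]
  simpa [Matrix.star_eq_conjTranspose] using this

lemma transpose_mul_self_orthogonal (hV : V ∈ Matrix.orthogonalGroup (Fin k) ℝ) :
    Vᵀ * V = 1 := by
  simpa [Matrix.star_eq_conjTranspose] using (Matrix.mem_orthogonalGroup_iff' (Fin k) ℝ).1 hV

lemma mul_transpose_self_orthogonal (hV : V ∈ Matrix.orthogonalGroup (Fin k) ℝ) :
    V * Vᵀ = 1 := by
  simpa [Matrix.star_eq_conjTranspose] using (Matrix.mem_orthogonalGroup_iff (Fin k) ℝ).1 hV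

/-- Rotating the data by `S` amounts to rotating the maximizer, which reduces the problem to the
unrotated data. -/
lemma IsVarimax.mul_transpose {n : ℕ} {Z : Matrix (Fin n) (Fin k) ℝ}
    {R S : Matrix (Fin k) (Fin k) ℝ} (hS : S ∈ Matrix.orthogonalGroup (Fin k) ℝ)
    (h : IsVarimax (Z * S) R) : IsVarimax Z (R * Sᵀ) := by
  refine ⟨mul_mem h.1 (transpose_mem_orthogonalGroup hS), fun Q hQ => ?_⟩
  have h1 := h.2 (Q * S) (mul_mem hQ hS)
  unfold varimaxObjective at *
  rw [Matrix.transpose_mul, Matrix.mul_assoc, ← Matrix.mul_assoc S,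
    mul_transpose_self_orthogonal hS, Matrix.one_mul] at h1
  rwa [Matrix.transpose_mul, Matrix.transpose_transpose, ← Matrix.mul_assoc]

section Frobenius
attribute [local instance] Matrix.frobeniusNormedAddCommGroup

lemma frobenius_sq (A : Matrix (Fin k) (Fin k) ℝ) : ‖A‖ ^ 2 = ∑ i, ∑ j, A i j ^ 2 := by
  rw [Matrix.frobenius_norm_def, ← Real.rpow_natCast, ← Real.rpow_mul (by positivity)]
  simp

lemma sum_sq_eq_trace (A : Matrix (Fin k) (Fin k) ℝ) :
    ∑ i, ∑ j, A i j ^ 2 = (A * Aᵀ).trace := by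
  simp [Matrix.trace, Matrix.mul_apply, sq]

lemma frobenius_sub_mul_sq {R S Q : Matrix (Fin k) (Fin k) ℝ}
    (hS : S ∈ Matrix.orthogonalGroup (Fin k) ℝ) :
    ‖R - Q * S‖ ^ 2 = ∑ i, ∑ j, ((R * Sᵀ) i j - Q i j) ^ 2 := by
  have h : R * Sᵀ - Q = (R - Q * S) * Sᵀ := by
    rw [Matrix.sub_mul, Matrix.mul_assoc, mul_transpose_self_orthogonal hS, Matrix.mul_one]
  have h2 : ∑ i, ∑ j, ((R * Sᵀ) i j - Q i j) ^ 2 = ∑ i, ∑ j, (R * Sᵀ - Q) i j ^ 2 := rfl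
  rw [frobenius_sq, h2, sum_sq_eq_trace, sum_sq_eq_trace, h, Matrix.transpose_mul,
    Matrix.transpose_transpose, Matrix.mul_assoc, ← Matrix.mul_assoc Sᵀ,
    transpose_mul_self_orthogonal hS, Matrix.one_mul]

lemma frobenius_orthogonal_sq (hV : V ∈ Matrix.orthogonalGroup (Fin k) ℝ) : ‖V‖ ^ 2 = k := by
  rw [frobenius_sq]
  simp [sum_row_sq hV]

lemma one_mem_signedPermutations : (1 : Matrix (Fin k) (Fin k) ℝ) ∈ signedPermutations k := by
  refine ⟨one_mem _, fun i j => ?_⟩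
  by_cases h : i = j
  · subst h; simp
  · simp [Matrix.one_apply_ne h]

lemma rotationDist_lt {R S Q : Matrix (Fin k) (Fin k) ℝ} {δ : ℝ} (hδ : 0 < δ) (hk : 1 ≤ k)
    (hS : S ∈ Matrix.orthogonalGroup (Fin k) ℝ) (hQ : Q ∈ signedPermutations k)
    (h : ∑ i, ∑ j, ((R * Sᵀ) i j - Q i j) ^ 2 < δ ^ 2 * k) : rotationDist S R < δ := by
  have hk' : (0 : ℝ) < k := by exact_mod_cast hk
  have hS2 := frobenius_orthogonal_sq hS
  have hpos : 0 < ‖S‖ := by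
    rcases (norm_nonneg S).eq_or_lt with h0 | h0
    · rw [← h0] at hS2; simp at hS2; linarith
    · exact h0
  refine lt_of_le_of_lt (ciInf_le ⟨0, ?_⟩ ⟨Q, hQ⟩) ?_
  · rintro _ ⟨P, rfl⟩
    positivity
  · rw [div_lt_iff₀ hpos]
    apply lt_of_pow_lt_pow_left₀ 2 (by positivity)
    rw [frobenius_sub_mul_sq hS, mul_pow, hS2]
    exact h

lemma exists_of_rotationDist_lt {R S : Matrix (Fin k) (Fin k) ℝ} {δ : ℝ} (hk : 1 ≤ k)
    (hS : S ∈ Matrix.orthogonalGroup (Fin k) ℝ) (h : rotationDist S R < δ) :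
    ∃ Q ∈ signedPermutations k, ∑ i, ∑ j, ((R * Sᵀ) i j - Q i j) ^ 2 < δ ^ 2 * k := by
  have hk' : (0 : ℝ) < k := by exact_mod_cast hk
  have hS2 := frobenius_orthogonal_sq hS
  have hpos : 0 < ‖S‖ := by
    rcases (norm_nonneg S).eq_or_lt with h0 | h0
    · rw [← h0] at hS2; simp at hS2; linarith
    · exact h0
  have : Nonempty (signedPermutations k) := ⟨⟨1, one_mem_signedPermutations⟩⟩
  obtain ⟨⟨Q, hQ⟩, hlt⟩ := exists_lt_of_ciInf_lt h
  refine ⟨Q, hQ, ?_⟩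
  rw [← frobenius_sub_mul_sq hS, ← hS2, ← mul_pow]
  simp only at hlt
  rw [div_lt_iff₀ hpos] at hlt
  gcongr

end Frobenius

/-- An orthogonal matrix with `∑ V j l ^ 4` close to `k` is close to a signed permutation: a row
with an entry of square greater than `1 / 2` is matched to that entry's column, and at most
one row claims each column. -/
lemma exists_signedPermutation_near (hV : V ∈ Matrix.orthogonalGroup (Fin k) ℝ) :
    ∃ Q ∈ signedPermutations k,
      ∑ i, ∑ j, (V i j - Q i j) ^ 2 ≤ 4 * (k - ∑ i, ∑ j, V i j ^ 4) := by
  classical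
  set G : Finset (Fin k) := Finset.univ.filter fun j => ∃ l, 1 / 2 < V j l ^ 2
  have hf : ∀ j, ∃ l, j ∈ G → 1 / 2 < V j l ^ 2 := by
    intro j
    by_cases hj : j ∈ G
    · obtain ⟨l, hl⟩ := (Finset.mem_filter.1 hj).2
      exact ⟨l, fun _ => hl⟩
    · exact ⟨j, fun h => absurd h hj⟩
  choose f hf using hf
  have hinj : Set.InjOn f G := by
    intro j hj j' hj' hjj
    by_contra hne
    have h1 := hf j hj
    have h2 := hf j' hj'
    rw [← hjj] at h2
    have h3 : V j (f j) ^ 2 + V j' (f j) ^ 2 ≤ ∑ i, V i (f j) ^ 2 := by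
      rw [← Finset.sum_pair (f := fun i => V i (f j) ^ 2) hne]
      exact Finset.sum_le_sum_of_subset_of_nonneg (Finset.subset_univ _)
        fun i _ _ => sq_nonneg _
    rw [sum_col_sq hV] at h3
    linarith
  obtain ⟨g, hg⟩ := Finset.exists_equiv_extend_of_card_eq (t := (Finset.univ : Finset (Fin k)))
    (by simp) (s := G) (f := f) (Finset.subset_univ _) hinj
  set σ : Fin k → Fin k := fun j => (g j : Fin k)
  have hσ : Function.Injective σ := fun a b hab => g.injective (Subtype.ext hab)
  set s : Fin k → ℝ := fun j => if 0 ≤ V j (σ j) then 1 else -1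
  have hs : ∀ j, s j = 1 ∨ s j = -1 := fun j => by simp only [s]; split_ifs <;> simp
  have hs2 : ∀ j, s j * s j = 1 := fun j => by rcases hs j with h | h <;> rw [h] <;> norm_num
  have hsV : ∀ j, s j * V j (σ j) = |V j (σ j)| := fun j => by
    simp only [s]
    split_ifs with h
    · rw [abs_of_nonneg h, one_mul]
    · rw [abs_of_neg (not_le.1 h)]; ring
  refine ⟨Matrix.of fun j l => if σ j = l then s j else 0, ⟨?_, ?_⟩, ?_⟩
  · rw [Matrix.mem_orthogonalGroup_iff]
    ext i j
    simp only [Matrix.mul_apply, Matrix.transpose_apply, Matrix.of_apply, Matrix.one_apply, ite_mul,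
      zero_mul, Finset.sum_ite_eq, Finset.mem_univ, if_true]
    by_cases hij : i = j
    · subst hij; simp [hs2]
    · have : σ j ≠ σ i := fun h => hij (hσ h).symm
      simp [hij, this]
  · intro i j
    simp only [Matrix.of_apply]
    split_ifs
    · exact Or.inr (hs i)
    · exact Or.inl rfl
  · have hk : (k : ℝ) = ∑ _i : Fin k, (1 : ℝ) := by simp
    rw [hk, ← Finset.sum_sub_distrib, Finset.mul_sum]
    refine Finset.sum_le_sum fun j _ => ?_
    have hrow := sum_row_sq hV j
    have e : ∑ l, (V j l - Matrix.of (fun j l => if σ j = l then s j else 0) j l) ^ 2 =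
        2 - 2 * |V j (σ j)| := by
      have : ∀ l, (V j l - Matrix.of (fun j l => if σ j = l then s j else 0) j l) ^ 2 =
          V j l ^ 2 + if σ j = l then 1 - 2 * (s j * V j l) else 0 := by
        intro l
        simp only [Matrix.of_apply]
        split_ifs
        · have := hs2 j
          linear_combination this
        · ring
      simp_rw [this, Finset.sum_add_distrib, hrow, Finset.sum_ite_eq, Finset.mem_univ, if_true, hsV]
      ring
    rw [e]
    have h4 : ∀ l, V j l ^ 2 ≤ 1 := fun l => by
      rw [← hrow]
      exact Finset.single_le_sum (f := fun l => V j l ^ 2) (fun _ _ => sq_nonneg _)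
        (Finset.mem_univ l)
    have hmax : ∀ m : ℝ, (∀ l, V j l ^ 2 ≤ m) → ∑ l, V j l ^ 4 ≤ m := by
      intro m hm
      calc ∑ l, V j l ^ 4 ≤ ∑ l, m * V j l ^ 2 := Finset.sum_le_sum fun l _ => by
            nlinarith [hm l, sq_nonneg (V j l)]
        _ = m := by rw [← Finset.mul_sum, hrow, mul_one]
    have habs : V j (σ j) ^ 2 ≤ |V j (σ j)| := by
      rw [← sq_abs]
      have h5 : |V j (σ j)| ≤ 1 := by
        rw [← sq_le_one_iff₀ (abs_nonneg _), sq_abs]; exact h4 _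
      nlinarith [abs_nonneg (V j (σ j))]
    by_cases hj : j ∈ G
    · have h1 := hf j hj
      have h2 : σ j = f j := hg j hj
      have h3 := hmax (V j (σ j) ^ 2) (fun l => by
        by_cases hl : l = σ j
        · rw [hl]
        · have : V j l ^ 2 + V j (σ j) ^ 2 ≤ ∑ i, V j i ^ 2 := by
            rw [← Finset.sum_pair (f := fun i => V j i ^ 2) hl]
            exact Finset.sum_le_sum_of_subset_of_nonneg (Finset.subset_univ _)
              fun i _ _ => sq_nonneg _
          rw [h2] at this ⊢
          linarith)
      have := h4 (σ j)
      linarith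
    · have h3 := hmax (1 / 2) (fun l => by
        by_contra hcon
        exact hj (Finset.mem_filter.2 ⟨Finset.mem_univ _, l, not_le.1 hcon⟩))
      have := abs_nonneg (V j (σ j))
      linarith

end orthogonal

/-- Rounding the coefficients of a linear form to the grid of mesh `n ^ (-10)` changes its fourth
power negligibly. -/
lemma abs_pow_four_sub_le {ι : Type*} [Fintype ι] {n : ℕ} (hn : 1 ≤ n) (hcard : Fintype.card ι ≤ n)
    {x u v : ι → ℝ} (hx : ∀ j, |x j| ≤ n) (hu : ∀ j, |u j| ≤ 1) (hv : ∀ j, |v j| ≤ 1)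
    (huv : ∀ j, |u j - v j| ≤ 1 / (n ^ 10 : ℕ)) :
    |∑ j, u j * x j - ∑ j, v j * x j| ≤ 1 / n ^ 8 ∧
    |(∑ j, u j * x j) ^ 4 - (∑ j, v j * x j) ^ 4| ≤ 4 / n ^ 2 := by
  have hn' : (1 : ℝ) ≤ n := by exact_mod_cast hn
  have hn0 : (0 : ℝ) < n := by linarith
  have hc : (Fintype.card ι : ℝ) ≤ n := by exact_mod_cast hcard
  have bd : ∀ w : ι → ℝ, (∀ j, |w j| ≤ 1) → |∑ j, w j * x j| ≤ n ^ 2 := by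
    intro w hw
    calc |∑ j, w j * x j| ≤ ∑ j, |w j * x j| := Finset.abs_sum_le_sum_abs _ _
      _ ≤ ∑ _j : ι, (n : ℝ) := Finset.sum_le_sum fun j _ => by
          rw [abs_mul]
          nlinarith [hw j, hx j, abs_nonneg (w j), abs_nonneg (x j)]
      _ = Fintype.card ι * n := by simp
      _ ≤ n ^ 2 := by rw [sq]; gcongr
  have hd : |∑ j, u j * x j - ∑ j, v j * x j| ≤ 1 / n ^ 8 := by
    rw [← Finset.sum_sub_distrib]
    calc |∑ j, (u j * x j - v j * x j)| ≤ ∑ j, |u j * x j - v j * x j| :=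
          Finset.abs_sum_le_sum_abs _ _
      _ ≤ ∑ _j : ι, 1 / (n : ℝ) ^ 9 := Finset.sum_le_sum fun j _ => by
          rw [← sub_mul, abs_mul]
          calc |u j - v j| * |x j| ≤ 1 / (n ^ 10 : ℕ) * n := by
                gcongr
                · exact huv j
                · exact hx j
            _ = 1 / n ^ 9 := by push_cast; field_simp
      _ = Fintype.card ι * (1 / n ^ 9) := by simp
      _ ≤ n * (1 / n ^ 9) := by gcongr
      _ = 1 / n ^ 8 := by field_simp
  refine ⟨hd, ?_⟩
  have hX := bd u hu
  have hY := bd v hv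
  generalize ∑ j, u j * x j = X at *
  generalize ∑ j, v j * x j = Y at *
  have e : X ^ 4 - Y ^ 4 = (X - Y) * (X ^ 3 + X ^ 2 * Y + X * Y ^ 2 + Y ^ 3) := by ring
  have h3 : |X ^ 3 + X ^ 2 * Y + X * Y ^ 2 + Y ^ 3| ≤ 4 * (n ^ 2) ^ 3 := by
    have a1 : |X ^ 3| ≤ (n ^ 2) ^ 3 := by rw [abs_pow]; gcongr
    have a2 : |X ^ 2 * Y| ≤ (n ^ 2) ^ 2 * n ^ 2 := by rw [abs_mul, abs_pow]; gcongr
    have a3 : |X * Y ^ 2| ≤ n ^ 2 * (n ^ 2) ^ 2 := by rw [abs_mul, abs_pow]; gcongr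
    have a4 : |Y ^ 3| ≤ (n ^ 2) ^ 3 := by rw [abs_pow]; gcongr
    calc _ ≤ |X ^ 3| + |X ^ 2 * Y| + |X * Y ^ 2| + |Y ^ 3| := by
          refine (abs_add_le _ _).trans (add_le_add_left ((abs_add_le _ _).trans
            (add_le_add_left (abs_add_le _ _) _)) _)
      _ ≤ _ := by nlinarith
  rw [e, abs_mul]
  calc _ ≤ 1 / (n : ℝ) ^ 8 * (4 * (n ^ 2) ^ 3) := by gcongr
    _ = 4 / n ^ 2 := by field_simp

/-! ### Uniform upper bound on the fourth moments -/

section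

variable {Ω : Type*} [MeasurableSpace Ω] {P : Measure Ω} {c : ℝ≥0} {κ : ℝ}

lemma varimaxObjective_eq {n k : ℕ} (Z : Matrix (Fin n) (Fin k) ℝ)
    (V : Matrix (Fin k) (Fin k) ℝ) :
    varimaxObjective Z V = ∑ j, ∑ i, (∑ l, V j l * Z i l) ^ 4 := by
  unfold varimaxObjective
  rw [Finset.sum_comm]
  simp only [Matrix.mul_apply, Matrix.transpose_apply]
  simp_rw [mul_comm]

lemma varimaxObjective_one {n k : ℕ} (Z : Matrix (Fin n) (Fin k) ℝ) :
    varimaxObjective Z 1 = ∑ i, ∑ j, Z i j ^ 4 := by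
  simp [varimaxObjective]

lemma abs_entry_le_one {k : ℕ} {V : Matrix (Fin k) (Fin k) ℝ}
    (hV : V ∈ Matrix.orthogonalGroup (Fin k) ℝ) (j l : Fin k) : |V j l| ≤ 1 := by
  rw [← sq_le_one_iff₀ (abs_nonneg _), sq_abs, ← sum_row_sq hV j]
  exact Finset.single_le_sum (f := fun l => V j l ^ 2) (fun _ _ => sq_nonneg _)
    (Finset.mem_univ l)

/-- If the empirical fourth moments are within `η` of their means on the grid, then a maximizer has
nearly maximal `∑ V j l ^ 4`. -/
lemma IsVarimax.sum_pow_four_ge {n k : ℕ} (hn : 1 ≤ n) (hkn : k ≤ n) {η : ℝ} (hκ : 3 ≤ κ)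
    {Z : Matrix (Fin n) (Fin k) ℝ} {V : Matrix (Fin k) (Fin k) ℝ} (hV : IsVarimax Z V)
    (hZ : ∀ i j, |Z i j| ≤ n) (hη : 4 / (n : ℝ) ^ 2 ≤ η)
    (hsum : n * k * κ - n * k * η ≤ ∑ i, ∑ j, Z i j ^ 4)
    (hgrid : ∀ v ∈ gridVectors (n ^ 10) (Finset.univ : Finset (Fin k)), ∑ l, v l ^ 2 ≤ 1 →
      ∑ i, (∑ l, v l * Z i l) ^ 4 ≤ n * (3 + (κ - 3) * ∑ l, v l ^ 4 + η)) :
    (κ - 3) * (k - ∑ j, ∑ l, V j l ^ 4) ≤ 3 * k * η := by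
  have hn0 : (0 : ℝ) < n := by exact_mod_cast hn
  have hM : 0 < n ^ 10 := by positivity
  have hcol : ∀ j, ∑ i, (∑ l, V j l * Z i l) ^ 4 ≤
      n * (3 + (κ - 3) * ∑ l, V j l ^ 4 + 2 * η) := by
    intro j
    have hu := abs_entry_le_one hV.1 j
    obtain ⟨v, hv, hvu⟩ := exists_gridVector hM (I := Finset.univ) hu (by simp)
    have hv1 : ∀ l, |v l| ≤ 1 := fun l => (hvu l).1.trans (hu l)
    have hsq : ∑ l, v l ^ 2 ≤ 1 := by
      rw [← sum_row_sq hV.1 j]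
      exact Finset.sum_le_sum fun l _ => sq_le_sq.2 (hvu l).1
    have hq : ∑ l, v l ^ 4 ≤ ∑ l, V j l ^ 4 := Finset.sum_le_sum fun l _ => by
      have := sq_le_sq.2 (hvu l).1
      calc v l ^ 4 = (v l ^ 2) ^ 2 := by ring
        _ ≤ (V j l ^ 2) ^ 2 := by gcongr
        _ = _ := by ring
    have h1 := hgrid v hv hsq
    have h2 : ∑ i, (∑ l, V j l * Z i l) ^ 4 ≤ ∑ i, ((∑ l, v l * Z i l) ^ 4 + η) :=
      Finset.sum_le_sum fun i _ => by
        have := (abs_pow_four_sub_le hn (by simpa using hkn) (hZ i) hu hv1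
          (fun l => (hvu l).2)).2
        have := (abs_le.1 this).2
        linarith
    rw [Finset.sum_add_distrib] at h2
    simp only [Finset.sum_const, Finset.card_univ, Fintype.card_fin, nsmul_eq_mul] at h2
    have h3 : (n : ℝ) * ((κ - 3) * ∑ l, v l ^ 4) ≤ n * ((κ - 3) * ∑ l, V j l ^ 4) := by
      have : 0 ≤ κ - 3 := by linarith
      gcongr
    nlinarith
  have hopt := hV.2 1 (one_mem _)
  rw [varimaxObjective_one, varimaxObjective_eq] at hopt
  have hS := Finset.sum_le_sum fun j (_ : j ∈ Finset.univ) => hcol j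
  rw [← Finset.mul_sum, Finset.sum_add_distrib, Finset.sum_add_distrib, ← Finset.mul_sum] at hS
  simp only [Finset.sum_const, Finset.card_univ, Fintype.card_fin, nsmul_eq_mul] at hS
  have h5 : (n : ℝ) * (k * κ - k * η) ≤
      n * (k * 3 + (κ - 3) * ∑ j, ∑ l, V j l ^ 4 + k * (2 * η)) := by linarith
  have h6 := le_of_mul_le_mul_left h5 hn0
  linarith

lemma card_grid_le_exp {n m : ℕ} (hn : 3 ≤ n) {k : ℕ} (I : Finset (Fin k)) (hI : I.card = m) :
    ((gridVectors (n ^ 10) I).card : ℝ) ≤ Real.exp (11 * m * Real.log n) := by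
  have hn0 : (0 : ℝ) < n := by positivity
  have h1 : 2 * n ^ 10 + 1 ≤ n ^ 11 := by
    have : 1 ≤ n ^ 10 := Nat.one_le_pow _ _ (by omega)
    calc 2 * n ^ 10 + 1 ≤ 3 * n ^ 10 := by omega
      _ ≤ n * n ^ 10 := by gcongr
      _ = n ^ 11 := by ring
  have h2 : (gridVectors (n ^ 10) I).card ≤ (n ^ 11) ^ m := by
    rw [← hI]
    exact (card_gridVectors_le _ _).trans (Nat.pow_le_pow_left h1 _)
  have h3 : Real.exp (11 * m * Real.log n) = ((n : ℝ) ^ 11) ^ m := by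
    rw [← pow_mul, ← Real.exp_log (pow_pos hn0 (11 * m)), Real.log_pow]
    push_cast; rfl
  rw [h3]
  exact_mod_cast h2

variable {n k : ℕ} {z : Fin n × Fin k → Ω → ℝ} [IsProbabilityMeasure P]

/-- Uniform upper deviation bound for the fourth moments of the rows over the grid. -/
lemma IsFactorVector.prob_grid_pow_four (h : IsFactorVector P c κ z) (hn : 3 ≤ n) (hk : 1 ≤ k)
    {η : ℝ} (hη : 0 < η) 
    (h1 : 192 * eighthBound (sqRate c) * (k * Real.log n) ≤ n * η ^ 2)
    (h2 : 1568 / sqRate c ^ 2 * (k ^ 2 * Real.log n ^ 2) ≤ n * η)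
    (h3 : 192 / sqRate c ^ 2 * (k * Real.log n ^ 3) ≤ n * η) :
    P.real {ω | ¬ ∀ v ∈ gridVectors (n ^ 10) (Finset.univ : Finset (Fin k)), ∑ l, v l ^ 2 ≤ 1 →
      ∑ i, (∑ l, v l * z (i, l) ω) ^ 4 ≤ n * (3 + (κ - 3) * ∑ l, v l ^ 4 + η)} ≤ 2 / n := by
  classical
  set a := sqRate c with ha_def
  set M8 := eighthBound a with hM8
  set L := Real.log n with hL
  have ha : 0 < a := sqRate_pos c
  have ha1 : a ≤ 1 := sqRate_le_one c
  have hM : 0 < M8 := by rw [hM8, eighthBound]; positivity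
  have hn0 : (0 : ℝ) < n := by positivity
  have hk1 : (1 : ℝ) ≤ k := by exact_mod_cast hk
  have hL1 : 1 ≤ L := by
    rw [hL, Real.le_log_iff_exp_le hn0]
    have := Real.exp_one_lt_d9
    have h3n : (3 : ℝ) ≤ n := by exact_mod_cast hn
    linarith
  have hkL : 1 ≤ k * L := by nlinarith
  -- the exponents: each grid point has probability at most `2 n ^ (-12 k)`
  have hfix : ∀ v : Fin k → ℝ, ∑ l, v l ^ 2 ≤ 1 →
      P.real {ω | n * (3 + (κ - 3) * ∑ l, v l ^ 4 + η) ≤ ∑ i, (∑ l, v l * z (i, l) ω) ^ 4} ≤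
        2 * Real.exp (-(12 * k * L)) := by
    intro v hv
    set m := 3 + (κ - 3) * ∑ l, v l ^ 4
    -- this truncation level makes the probability of an excess at most a multiple of `1 / n`
    set B := 2 * L / a with hB
    have hB0 : 0 < B := by positivity
    -- the optimal Chernoff parameter, unless the truncation level forces a smaller one
    set l := min (η / (4 * M8)) (1 / B ^ 2)
    have hl0 : 0 < l := lt_min (by positivity) (by positivity)
    have hlB : l * B ^ 2 ≤ 1 := by
      calc l * B ^ 2 ≤ 1 / B ^ 2 * B ^ 2 := by gcongr; exact min_le_right _ _
        _ = 1 := by field_simp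
    have ht0 : 0 ≤ n * η / 2 := by positivity
    have key := h.prob_pow_four_le hv (s := n * m + n * η / 2) (t := √(n * η / 2)) (m := m)
      hl0.le hB0.le hlB le_rfl
    rw [Real.sq_sqrt ht0, show n * m + n * η / 2 + n * η / 2 = n * (m + η) by ring] at key
    refine (le_trans (le_of_eq rfl) key).trans ?_
    rw [two_mul (Real.exp (-(12 * k * L)))]
    refine add_le_add (Real.exp_le_exp.2 ?_) (Real.exp_le_exp.2 ?_)
    · simp only [Fintype.card_fin]
      have e1 : l * M8 ≤ η / 4 := by
        calc l * M8 ≤ η / (4 * M8) * M8 := by gcongr; exact min_le_left _ _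
          _ = η / 4 := by field_simp
      have e2 : n * (l ^ 2 * M8) ≤ n * (l * (η / 4)) := by
        rw [sq, mul_assoc]; gcongr
      have e3 : 12 * k * L ≤ n * (l * (η / 4)) := by
        rcases min_cases (η / (4 * M8)) (1 / B ^ 2) with ⟨hh, -⟩ | ⟨hh, -⟩
        · have : l = η / (4 * M8) := hh
          rw [this]
          have : n * (η / (4 * M8) * (η / 4)) = n * η ^ 2 / (16 * M8) := by field_simp; ring
          rw [this, le_div_iff₀ (by positivity)]
          linarith
        · have : l = 1 / B ^ 2 := hh
          rw [this, hB]
          have : n * (1 / (2 * L / a) ^ 2 * (η / 4)) = n * η * (a ^ 2 / (16 * L ^ 2)) := by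
            field_simp; ring
          rw [this]
          calc 12 * k * L = 192 / a ^ 2 * (k * L ^ 3) * (a ^ 2 / (16 * L ^ 2)) := by
                field_simp; ring
            _ ≤ _ := by gcongr
      nlinarith
    · simp only [Fintype.card_fin]
      have e1 : Real.exp (-(a * B / 2)) = 1 / n := by
        have : a * B / 2 = L := by rw [hB]; field_simp
        rw [this, Real.exp_neg, Real.exp_log hn0, one_div]
      rw [e1]
      have e2 : n * (2 * (1 / (n : ℝ))) = 2 := by field_simp
      rw [e2]
      have e3 : 28 * (k * L) / a ≤ √(n * η / 2) := by
        apply Real.le_sqrt_of_sq_le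
        have : (28 * (k * L) / a) ^ 2 = 1568 / a ^ 2 * (k ^ 2 * L ^ 2) / 2 := by
          field_simp; ring
        rw [this]
        linarith
      have e4 : a / 2 * (28 * (k * L) / a) = 14 * (k * L) := by field_simp; ring
      have e5 : a / 2 * (28 * (k * L) / a) ≤ a / 2 * √(n * η / 2) := by gcongr
      linarith
  set S := (gridVectors (n ^ 10) (Finset.univ : Finset (Fin k))).filter
    fun v => ∑ l, v l ^ 2 ≤ 1
  have hS : (S.card : ℝ) ≤ Real.exp (11 * k * L) := by
    refine le_trans ?_ (card_grid_le_exp hn (Finset.univ : Finset (Fin k)) (by simp))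
    exact_mod_cast Finset.card_filter_le _ _
  have hU := measureReal_biUnion_le_card_mul S (P := P)
    (fun v => {ω | n * (3 + (κ - 3) * ∑ l, v l ^ 4 + η) ≤ ∑ i, (∑ l, v l * z (i, l) ω) ^ 4})
    (fun v hv => hfix v (Finset.mem_filter.1 hv).2)
  refine (measureReal_mono ?_ (measure_ne_top _ _)).trans (hU.trans ?_)
  · intro ω hω
    simp only [Set.mem_ofPred_eq] at hω
    push Not at hω
    obtain ⟨v, hv, hv1, hlt⟩ := hω
    simp only [Set.mem_iUnion]
    exact ⟨v, Finset.mem_filter.2 ⟨hv, hv1⟩, hlt.le⟩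
  · calc S.card * (2 * Real.exp (-(12 * k * L))) ≤
        Real.exp (11 * k * L) * (2 * Real.exp (-(12 * k * L))) := by gcongr
      _ = 2 * Real.exp (-(k * L)) := by
          rw [mul_left_comm, ← Real.exp_add]; ring_nf
      _ ≤ 2 * Real.exp (-L) := by
          gcongr
          nlinarith
      _ = 2 / n := by rw [Real.exp_neg, Real.exp_log hn0]; ring

end

/-! ### Consistency for large samples -/

/-- The entries of a factor matrix are only almost everywhere measurable; measurable versions of
them have the same moments and are still independent. -/
lemma IsFactorMatrix.exists_measurable {Ω : Type*} [MeasurableSpace Ω] {P : Measure Ω} {c : ℝ≥0}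
    {κ : ℝ} {n k : ℕ} {Z : Ω → Matrix (Fin n) (Fin k) ℝ} (h : IsFactorMatrix P c κ Z) :
    ∃ z : Fin n × Fin k → Ω → ℝ, IsFactorVector P c κ z ∧
      ∀ᵐ ω ∂P, Z ω = Matrix.of fun i j => z (i, j) ω := by
  have hm : ∀ p : Fin n × Fin k, AEMeasurable (fun ω => Z ω p.1 p.2) P := fun p =>
    (h.ident p p).aemeasurable_fst
  have hae : ∀ᵐ ω ∂P, ∀ p : Fin n × Fin k, Z ω p.1 p.2 = (hm p).mk _ ω :=
    ae_all_iff.2 fun p => (hm p).ae_eq_mk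
  have hae' : ∀ᵐ ω ∂P, Z ω = Matrix.of fun i j => (hm (i, j)).mk _ ω := by
    filter_upwards [hae] with ω hω
    ext i j
    exact hω (i, j)
  have hZ' : IsFactorMatrix P c κ
      (fun ω => (Matrix.of fun i j => (hm (i, j)).mk _ ω : Matrix (Fin n) (Fin k) ℝ)) := by
    have e : ∀ p : Fin n × Fin k, (fun ω => Z ω p.1 p.2) =ᵐ[P] (hm p).mk _ :=
      fun p => (hm p).ae_eq_mk
    have ei : ∀ i j (m : ℕ), ∫ ω, (hm (i, j)).mk _ ω ^ m ∂P = ∫ ω, Z ω i j ^ m ∂P := fun i j m =>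
      integral_congr_ae ((e (i, j)).mono fun ω hω => congrArg (· ^ m) hω.symm)
    refine ⟨h.indep.congr e, fun p q => ?_, fun i j => ?_, fun i j => ?_, fun i j => ?_,
      fun i j => ?_, fun i j => (h.subgaussian i j).congr (e (i, j))⟩
    · exact ((IdentDistrib.of_ae_eq (hm p) (e p)).symm.trans (h.ident p q)).trans
        (IdentDistrib.of_ae_eq (hm q) (e q))
    · rw [← h.moment_one i j]
      simpa using ei i j 1
    · exact (ei i j 2).trans (h.moment_two i j)
    · exact (ei i j 3).trans (h.moment_three i j)
    · exact (ei i j 4).trans (h.moment_four i j)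
  exact ⟨fun p => (hm p).mk _, hZ'.entries fun i j => (hm (i, j)).measurable_mk, hae'⟩

lemma tendsto_log_natCast : Filter.Tendsto (fun n : ℕ => Real.log n) Filter.atTop Filter.atTop :=
  Real.tendsto_log_atTop.comp tendsto_natCast_atTop_atTop

lemma eventually_log_pow_le (D : ℝ) (m : ℕ) :
    ∀ᶠ n : ℕ in Filter.atTop, D * Real.log n ^ m ≤ n := by
  have h1 : (fun x : ℝ => Real.log x ^ m) =o[Filter.atTop] fun x => x :=
    Real.isLittleO_pow_log_id_atTop
  have h2 := h1.comp_tendsto (tendsto_natCast_atTop_atTop (R := ℝ))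
  have hc : 0 < 1 / (|D| + 1) := by positivity
  filter_upwards [h2.def hc, Filter.eventually_ge_atTop 1] with n hn hn1
  simp only [Function.comp, Real.norm_eq_abs, Nat.abs_cast] at hn
  have h3 : (0 : ℝ) ≤ n := by positivity
  calc D * Real.log n ^ m ≤ |D| * |Real.log n ^ m| := by
        rw [← abs_mul]; exact le_abs_self _
    _ ≤ (|D| + 1) * |Real.log n ^ m| := by gcongr; linarith
    _ ≤ (|D| + 1) * (1 / (|D| + 1) * n) := by gcongr
    _ = n := by field_simp

/-- What the lower bound on the sample size gives for the deviation `η₀ t`, where `t = κ - 3` and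
`L = log n`. -/
lemma sampleSize_consequences {a M8 η₀ C C₃ n k L t : ℝ} (ha : 0 < a) (hM : 0 < M8) (hη : 0 < η₀)
    (hn1 : 1 ≤ n) (hk1 : 1 ≤ k) (hL1 : 1 ≤ L) (ht0 : 0 < t) (htC : t ≤ C₃)
    (hC : C = 1 + 192 * M8 / η₀ ^ 2 + 1568 / (a ^ 2 * η₀) + C₃)
    (H1 : C * (k * L) ≤ n * t ^ 2) (H2 : C * (k ^ 2 * L ^ 2) ≤ n * t)
    (hlog : (192 / (a ^ 2 * η₀)) ^ 2 * L ^ 6 ≤ n) (hnη : 4 / η₀ ≤ n) :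
    k ≤ n ∧ 192 * M8 * (k * L) ≤ n * (η₀ * t) ^ 2 ∧
      1568 / a ^ 2 * (k ^ 2 * L ^ 2) ≤ n * (η₀ * t) ∧
      192 / a ^ 2 * (k * L ^ 3) ≤ n * (η₀ * t) ∧ 4 / n ^ 2 ≤ η₀ * t ∧ k * L ≤ n * t ^ 2 := by
  have hC₃ : 0 < C₃ := by linarith
  have hn0 : 0 < n := by linarith
  set D := 192 / (a ^ 2 * η₀) with hD
  have hD0 : 0 < D := by positivity
  have b1 : 0 < 192 * M8 / η₀ ^ 2 := by positivity
  have b2 : 0 < 1568 / (a ^ 2 * η₀) := by positivity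
  have b3 : D ≤ 1568 / (a ^ 2 * η₀) := by rw [hD]; gcongr; norm_num
  have hC0 : 0 < C := by linarith
  have hC1 : 1 ≤ C := by linarith
  have hCD : D ≤ C := by linarith
  have c1 : 192 * M8 / η₀ ^ 2 ≤ C := by linarith
  have c2 : 1568 / (a ^ 2 * η₀) ≤ C := by linarith
  have c3 : C₃ ≤ C := by linarith
  have hkL : 1 ≤ k * L := by nlinarith
  have hkL2 : k ^ 2 ≤ k ^ 2 * L ^ 2 := le_mul_of_one_le_right (by positivity) (by nlinarith)
  have hkn : k ≤ n := by
    have h1 : C₃ * k ^ 2 ≤ C₃ * n := by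
      calc C₃ * k ^ 2 ≤ C * (k ^ 2 * L ^ 2) := by
            gcongr
        _ ≤ n * t := H2
        _ ≤ n * C₃ := by gcongr
        _ = _ := by ring
    have h2 := le_of_mul_le_mul_left h1 hC₃
    nlinarith
  set η := η₀ * t with hηt
  have hη0 : 0 < η := by positivity
  have h1 : 192 * M8 * (k * L) ≤ n * η ^ 2 := by
    calc 192 * M8 * (k * L) = η₀ ^ 2 * (192 * M8 / η₀ ^ 2 * (k * L)) := by field_simp
      _ ≤ η₀ ^ 2 * (C * (k * L)) := by gcongr
      _ ≤ η₀ ^ 2 * (n * t ^ 2) := by gcongr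
      _ = n * η ^ 2 := by rw [hηt]; ring
  have h2 : 1568 / a ^ 2 * (k ^ 2 * L ^ 2) ≤ n * η := by
    calc 1568 / a ^ 2 * (k ^ 2 * L ^ 2) = η₀ * (1568 / (a ^ 2 * η₀) * (k ^ 2 * L ^ 2)) := by
          field_simp
      _ ≤ η₀ * (C * (k ^ 2 * L ^ 2)) := by gcongr
      _ ≤ η₀ * (n * t) := by gcongr
      _ = n * η := by rw [hηt]; ring
  -- for `k < log n` the first condition on `n` already dominates `k log ^ 3 n`
  have h3' : D * (k * L ^ 3) ≤ n * t := by
    rcases le_total L k with hLk | hLk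
    · calc D * (k * L ^ 3) = D * (k * L * L ^ 2) := by ring
        _ ≤ C * (k * k * L ^ 2) := by gcongr
        _ = C * (k ^ 2 * L ^ 2) := by ring
        _ ≤ n * t := H2
    · have hkL' : k ≤ L := hLk
      refine (pow_le_pow_iff_left₀ (by positivity) (by positivity) two_ne_zero).1 ?_
      calc (D * (k * L ^ 3)) ^ 2 = (D ^ 2 * (k * L ^ 5)) * (k * L) := by ring
        _ ≤ (D ^ 2 * (L * L ^ 5)) * (k * L) := by gcongr
        _ = D ^ 2 * L ^ 6 * (k * L) := by ring
        _ ≤ n * (k * L) := by gcongr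
        _ ≤ n * (C * (k * L)) :=
            mul_le_mul_of_nonneg_left (le_mul_of_one_le_left (by positivity) hC1) hn0.le
        _ ≤ n * (n * t ^ 2) := by gcongr
        _ = (n * t) ^ 2 := by ring
  have h3 : 192 / a ^ 2 * (k * L ^ 3) ≤ n * η := by
    calc 192 / a ^ 2 * (k * L ^ 3) = η₀ * (D * (k * L ^ 3)) := by rw [hD]; field_simp
      _ ≤ η₀ * (n * t) := by gcongr
      _ = n * η := by rw [hηt]; ring
  have hCkL : 1 ≤ n * t ^ 2 := by nlinarith
  have h4 : 4 / n ^ 2 ≤ η := by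
    have h5 : 1 / n ≤ t := by
      rw [div_le_iff₀ hn0]
      nlinarith
    calc 4 / n ^ 2 = 4 / n * (1 / n) := by field_simp
      _ ≤ η₀ * t := by
        gcongr
        rw [div_le_iff₀ hn0]
        rw [div_le_iff₀ hη] at hnη
        linarith
  exact ⟨hkn, h1, h2, h3, h4, (le_mul_of_one_le_left (by positivity) hC1).trans H1⟩

/-- Outside three events of vanishing probability (an entry above `n`, a small fourth moment at the
identity, a large fourth moment on the grid) every maximizer is within `δ` of `Rstar`. -/
theorem varimax_consistent (c : ℝ≥0) (C₀ δ : ℝ) (hC₀ : 3 < C₀) (hδ : 0 < δ) :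
    ∃ C : ℝ, 0 < C ∧ ∀ ε : ℝ, 0 < ε → ∃ N : ℕ, ∀ n k : ℕ, N ≤ n → 1 ≤ k →
      ∀ κ : ℝ, 3 < κ → κ ≤ C₀ →
      C * max ((k : ℝ) * Real.log n / (κ - 3) ^ 2)
        ((k : ℝ) ^ 2 * Real.log n ^ 2 / (κ - 3)) ≤ (n : ℝ) →
      ∀ (Ω : Type*) [MeasurableSpace Ω] (P : Measure Ω) [IsProbabilityMeasure P]
        (Z : Ω → Matrix (Fin n) (Fin k) ℝ) (Rstar : Matrix (Fin k) (Fin k) ℝ)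
        (Rhat : Ω → Matrix (Fin k) (Fin k) ℝ),
        IsFactorMatrix P c κ Z →
        Rstar ∈ Matrix.orthogonalGroup (Fin k) ℝ →
        (∀ᵐ ω ∂P, IsVarimax (Z ω * Rstar) (Rhat ω)) →
        P.real {ω | δ ≤ rotationDist Rstar (Rhat ω)} ≤ ε := by
  set a := sqRate c with ha_def
  set M8 := eighthBound a with hM8
  have ha : 0 < a := sqRate_pos c
  have hM : 0 < M8 := by rw [hM8, eighthBound]; positivity
  -- `∑ (V - Q) ^ 2 ≤ 4 * 3 k η₀ < δ ^ 2 k` at a maximizer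
  set η₀ := δ ^ 2 / 16 with hη₀
  have hη : 0 < η₀ := by positivity
  set D := 192 / (a ^ 2 * η₀) with hD
  have hD0 : 0 < D := by positivity
  set C := 1 + 192 * M8 / η₀ ^ 2 + 1568 / (a ^ 2 * η₀) + (C₀ - 3) with hC
  have b1 : 0 < 192 * M8 / η₀ ^ 2 := by positivity
  have b2 : 0 < 1568 / (a ^ 2 * η₀) := by positivity
  have hC0 : 0 < C := by linarith
  refine ⟨C, hC0, fun ε hε => ?_⟩
  have hlim : Filter.Tendsto (fun n : ℕ => C₀ / n ^ 2 + M8 / η₀ ^ 2 / Real.log n + 2 / n)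
      Filter.atTop (nhds (0 + 0 + 0)) :=
    ((tendsto_const_nhds.div_atTop ((Filter.tendsto_pow_atTop two_ne_zero).comp
      tendsto_natCast_atTop_atTop)).add (tendsto_const_nhds.div_atTop tendsto_log_natCast)).add
      (tendsto_const_nhds.div_atTop tendsto_natCast_atTop_atTop)
  rw [add_zero, add_zero] at hlim
  obtain ⟨N, hN⟩ := Filter.eventually_atTop.1 ((hlim.eventually_le_const hε).and
    ((eventually_log_pow_le (D ^ 2) 6).and ((Filter.eventually_ge_atTop 3).and
      (tendsto_natCast_atTop_atTop.eventually_ge_atTop (4 / η₀)))))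
  refine ⟨N, fun n k hn hk κ hκ hκC hnk Ω _ P _ Z Rstar Rhat hZ hR hopt => ?_⟩
  obtain ⟨hε', hlog, hn3, hnη⟩ := hN n hn
  set L := Real.log n with hL
  have hn0 : (0 : ℝ) < n := by positivity
  have hn1 : (1 : ℝ) ≤ n := by exact_mod_cast (by omega : 1 ≤ n)
  have hk1 : (1 : ℝ) ≤ k := by exact_mod_cast hk
  have hL1 : 1 ≤ L := by
    rw [hL, Real.le_log_iff_exp_le hn0]
    have := Real.exp_one_lt_d9
    have h3n : (3 : ℝ) ≤ n := by exact_mod_cast hn3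
    linarith
  set t := κ - 3 with ht
  have ht0 : 0 < t := by linarith
  have H1 : C * (k * L) ≤ n * t ^ 2 := by
    have := (mul_le_mul_of_nonneg_left (le_max_left _ _) hC0.le).trans hnk
    rwa [← mul_div_assoc, div_le_iff₀ (by positivity)] at this
  have H2 : C * (k ^ 2 * L ^ 2) ≤ n * t := by
    have := (mul_le_mul_of_nonneg_left (le_max_right _ _) hC0.le).trans hnk
    rwa [← mul_div_assoc, div_le_iff₀ (by positivity)] at this
  obtain ⟨hkn, h1, h2, h3, h4, h6⟩ := sampleSize_consequences (M8 := M8) ha hM hη hn1 hk1 hL1 ht0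
    (by linarith : t ≤ C₀ - 3) hC H1 H2 hlog hnη
  set η := η₀ * t with hηt
  have hη0 : 0 < η := by positivity
  obtain ⟨z, hz, hzZ⟩ := hZ.exists_measurable
  set A1 := {ω | ∃ p, (n : ℝ) < |z p ω|}
  set A2 := {ω | n * k * η ≤ |∑ p, z p ω ^ 4 - Fintype.card (Fin n × Fin k) * κ|}
  set A3 := {ω | ¬ ∀ v ∈ gridVectors (n ^ 10) (Finset.univ : Finset (Fin k)), ∑ l, v l ^ 2 ≤ 1 →
      ∑ i, (∑ l, v l * z (i, l) ω) ^ 4 ≤ n * (3 + (κ - 3) * ∑ l, v l ^ 4 + η)}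
  have p1 : P.real A1 ≤ C₀ / n ^ 2 := by
    refine (hz.prob_exists_large hn0).trans ?_
    simp only [Fintype.card_prod, Fintype.card_fin, Nat.cast_mul]
    rw [div_le_div_iff₀ (by positivity) (by positivity)]
    calc (n : ℝ) * k * κ * n ^ 2 ≤ n * n * C₀ * n ^ 2 := by gcongr
      _ = _ := by ring
  have p2 : P.real A2 ≤ M8 / η₀ ^ 2 / L := by
    refine (hz.prob_sum_pow_four (by positivity)).trans ?_
    simp only [Fintype.card_prod, Fintype.card_fin, Nat.cast_mul]
    have e : n * k * eighthBound (sqRate c) / (n * k * η) ^ 2 =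
        M8 / η₀ ^ 2 / (k * (n * t ^ 2)) := by
      rw [hηt]; field_simp; rfl
    rw [e]
    gcongr
    calc L ≤ k * L := le_mul_of_one_le_left (by positivity) hk1
      _ ≤ n * t ^ 2 := h6
      _ ≤ k * (n * t ^ 2) := le_mul_of_one_le_left (by positivity) hk1
  have p3 : P.real A3 ≤ 2 / n := hz.prob_grid_pow_four hn3 hk hη0 h1 h2 h3
  have hsub : {ω | δ ≤ rotationDist Rstar (Rhat ω)} ≤ᵐ[P] (A1 ∪ A2 ∪ A3 : Set Ω) := by
    filter_upwards [hopt, hzZ] with ω ho hzω hbad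
    by_contra hcon
    have hcon' : ω ∉ A1 ∪ A2 ∪ A3 := hcon
    simp only [Set.mem_union, not_or] at hcon'
    obtain ⟨⟨n1, n2⟩, n3⟩ := hcon'
    simp only [A1, A2, A3, Set.mem_ofPred_eq, not_exists, not_lt, not_le, not_not] at n1 n2 n3
    have hV := ho.mul_transpose hR
    rw [hzω] at hV
    have key := hV.sum_pow_four_ge (by omega) (by exact_mod_cast hkn) hκ.le
      (fun i j => n1 (i, j)) h4
      (by
        have := (abs_lt.1 n2).1
        simp only [Fintype.card_prod, Fintype.card_fin, Nat.cast_mul,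
          Fintype.sum_prod_type] at this
        simp only [Matrix.of_apply]
        linarith) n3
    obtain ⟨Q, hQ, hQd⟩ := exists_signedPermutation_near hV.1
    have hbad' : δ ≤ rotationDist Rstar (Rhat ω) := hbad
    refine absurd hbad' (not_le.2 (rotationDist_lt hδ hk hR hQ (lt_of_le_of_lt hQd ?_)))
    have h7 : t * (k - ∑ j, ∑ l, (Rhat ω * Rstarᵀ) j l ^ 4) ≤ t * (3 * k * η₀) := by
      refine key.trans (le_of_eq ?_)
      rw [hηt]; ring
    have h8 := le_of_mul_le_mul_left h7 ht0
    have h9 : 0 < δ ^ 2 * k := by positivity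
    rw [hη₀] at h8
    linarith
  calc P.real {ω | δ ≤ rotationDist Rstar (Rhat ω)} ≤ P.real (A1 ∪ A2 ∪ A3) :=
        ENNReal.toReal_mono (measure_ne_top _ _) (measure_mono_ae hsub)
    _ ≤ P.real A1 + P.real A2 + P.real A3 :=
        (measureReal_union_le _ _).trans (add_le_add_left (measureReal_union_le _ _) _)
    _ ≤ C₀ / n ^ 2 + M8 / η₀ ^ 2 / L + 2 / n := by linarith
    _ ≤ ε := hε'

/-! ### Projections of a row onto a subspace -/

section

variable {Ω : Type*} [MeasurableSpace Ω] {P : Measure Ω} {c : ℝ≥0} {κ : ℝ}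

section variance
variable {ι : Type*} [Fintype ι] {z : ι → Ω → ℝ} [IsProbabilityMeasure P]

lemma IsFactorVector.integrable_linForm_pow (h : IsFactorVector P c κ z) (u : ι → ℝ) (m : ℕ) :
    Integrable (fun ω => linForm z u ω ^ m) P :=
  integrable_pow_of_memLp (fun p => h.memLp_linForm u p) m

lemma IsFactorVector.integrable_linForm_sq_mul_sq (h : IsFactorVector P c κ z) (u v : ι → ℝ) :
    Integrable (fun ω => linForm z u ω ^ 2 * linForm z v ω ^ 2) P := by
  refine Integrable.mono' ((h.integrable_linForm_pow u 4).add (h.integrable_linForm_pow v 4))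
    ?_ (Filter.Eventually.of_forall fun ω => ?_)
  · have h1 := h.measurable_linForm u
    have h2 := h.measurable_linForm v
    fun_prop
  · rw [Real.norm_of_nonneg (by positivity)]
    simp only [Pi.add_apply]
    nlinarith [sq_nonneg (linForm z u ω ^ 2 - linForm z v ω ^ 2), sq_nonneg (linForm z u ω ^ 2),
      sq_nonneg (linForm z v ω ^ 2)]

/-- Mixed fourth moments of linear forms, obtained from the fourth moments by polarization. -/
lemma IsFactorVector.integral_linForm_sq_mul_sq (h : IsFactorVector P c κ z) (u v : ι → ℝ) :
    ∫ ω, linForm z u ω ^ 2 * linForm z v ω ^ 2 ∂P =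
      (∑ a, u a ^ 2) * (∑ a, v a ^ 2) + 2 * (∑ a, u a * v a) ^ 2 +
        (κ - 3) * ∑ a, u a ^ 2 * v a ^ 2 := by
  have e1 : ∀ ω, linForm z (u + v) ω = linForm z u ω + linForm z v ω := fun ω => by
    simp [linForm, add_mul, Finset.sum_add_distrib]
  have e2 : ∀ ω, linForm z (u - v) ω = linForm z u ω - linForm z v ω := fun ω => by
    simp [linForm, sub_mul, Finset.sum_sub_distrib]
  have e3 : ∀ ω, linForm z u ω ^ 2 * linForm z v ω ^ 2 = 1 / 12 * (linForm z (u + v) ω ^ 4 +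
      linForm z (u - v) ω ^ 4) - 1 / 6 * (linForm z u ω ^ 4 + linForm z v ω ^ 4) := fun ω => by
    rw [e1, e2]; ring
  have i4 := fun w => h.integrable_linForm_pow w 4
  simp_rw [e3]
  have i5 : ∀ w w' : ι → ℝ, Integrable (fun ω => linForm z w ω ^ 4 + linForm z w' ω ^ 4) P :=
    fun w w' => (i4 w).add (i4 w')
  rw [integral_sub ((i5 _ _).const_mul _) ((i5 _ _).const_mul _),
    integral_const_mul, integral_const_mul, integral_add (i4 _) (i4 _),
    integral_add (i4 _) (i4 _)]
  simp only [h.integral_linForm_pow_four, Pi.add_apply, Pi.sub_apply]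
  have s1 : ∑ a, (u a + v a) ^ 2 = ∑ a, u a ^ 2 + 2 * ∑ a, u a * v a + ∑ a, v a ^ 2 := by
    rw [Finset.mul_sum, ← Finset.sum_add_distrib, ← Finset.sum_add_distrib]
    exact Finset.sum_congr rfl fun a _ => by ring
  have s2 : ∑ a, (u a - v a) ^ 2 = ∑ a, u a ^ 2 - 2 * ∑ a, u a * v a + ∑ a, v a ^ 2 := by
    rw [Finset.mul_sum, ← Finset.sum_sub_distrib, ← Finset.sum_add_distrib]
    exact Finset.sum_congr rfl fun a _ => by ring
  have s3 : ∑ a, (u a + v a) ^ 4 + ∑ a, (u a - v a) ^ 4 =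
      2 * ∑ a, u a ^ 4 + 12 * ∑ a, u a ^ 2 * v a ^ 2 + 2 * ∑ a, v a ^ 4 := by
    simp only [Finset.mul_sum, ← Finset.sum_add_distrib]
    exact Finset.sum_congr rfl fun a _ => by ring
  rw [s1, s2]
  linear_combination (κ - 3) / 12 * s3

/-- A family of pairwise orthogonal vectors of norm at most one. -/
structure IsSubOrthonormal {τ : Type*} (b : τ → ι → ℝ) : Prop where
  orth : ∀ i j, i ≠ j → ∑ a, b i a * b j a = 0
  norm_le : ∀ i, ∑ a, b i a ^ 2 ≤ 1

omit [MeasurableSpace Ω] [IsProbabilityMeasure P] in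
lemma IsSubOrthonormal.sum_coord_sq_le {τ : Type*} {b : τ → ι → ℝ} (hb : IsSubOrthonormal b)
    (s : Finset τ) (a : ι) : ∑ i ∈ s, b i a ^ 2 ≤ 1 := by
  classical
  set v : ι → ℝ := fun x => ∑ i ∈ s, b i a * b i x
  have h0 : 0 ≤ ∑ x, ((Pi.single a 1 : ι → ℝ) x - v x) ^ 2 :=
    Finset.sum_nonneg fun x _ => sq_nonneg _
  have h1 : ∑ x, ((Pi.single a 1 : ι → ℝ) x - v x) ^ 2 = 1 - 2 * v a + ∑ x, v x ^ 2 := by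
    have : ∀ x, ((Pi.single a 1 : ι → ℝ) x - v x) ^ 2 =
        (if x = a then 1 - 2 * v x else 0) + v x ^ 2 := fun x => by
      by_cases hx : x = a
      · subst hx; simp; ring
      · simp [hx]
    simp_rw [this, Finset.sum_add_distrib, Finset.sum_ite_eq', Finset.mem_univ, if_true]
  have h2 : v a = ∑ i ∈ s, b i a ^ 2 := Finset.sum_congr rfl fun i _ => (sq _).symm
  have h3 : ∑ x, v x ^ 2 ≤ ∑ i ∈ s, b i a ^ 2 := by
    have e : ∑ x, v x ^ 2 = ∑ i ∈ s, ∑ j ∈ s, b i a * b j a * ∑ x, b i x * b j x := by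
      simp_rw [v, sq, Finset.sum_mul_sum]
      rw [Finset.sum_comm]
      refine Finset.sum_congr rfl fun i _ => ?_
      rw [Finset.sum_comm]
      refine Finset.sum_congr rfl fun j _ => ?_
      rw [Finset.mul_sum]
      exact Finset.sum_congr rfl fun x _ => by ring
    rw [e]
    refine Finset.sum_le_sum fun i hi => ?_
    rw [Finset.sum_eq_single_of_mem i hi fun j _ hji => by rw [hb.orth i j hji.symm, mul_zero]]
    simp_rw [← sq]
    exact mul_le_of_le_one_right (sq_nonneg _) (hb.norm_le i)
  linarith

/-- The squared length of the projection of a row onto a fixed subspace concentrates: its variance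
is at most proportional to the dimension. -/
lemma IsFactorVector.variance_projection_le (h : IsFactorVector P c κ z) (hκ : 3 ≤ κ)
    {τ : Type*} {b : τ → ι → ℝ} (hb : IsSubOrthonormal b) (s : Finset τ) :
    ∫⁻ ω, ENNReal.ofReal ((∑ i ∈ s, linForm z (b i) ω ^ 2 - ∑ i ∈ s, ∑ a, b i a ^ 2) ^ 2) ∂P ≤
      ENNReal.ofReal ((κ - 1) * s.card) := by
  set S := ∑ i ∈ s, ∑ a, b i a ^ 2
  have e1 : ∀ ω, (∑ i ∈ s, linForm z (b i) ω ^ 2 - S) ^ 2 =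
      ∑ i ∈ s, ∑ j ∈ s, linForm z (b i) ω ^ 2 * linForm z (b j) ω ^ 2 -
        2 * S * ∑ i ∈ s, linForm z (b i) ω ^ 2 + S ^ 2 := fun ω => by
    rw [← Finset.sum_mul_sum]; ring
  have i2 : Integrable (fun ω => ∑ i ∈ s, ∑ j ∈ s,
      linForm z (b i) ω ^ 2 * linForm z (b j) ω ^ 2) P :=
    integrable_finsetSum _ fun i _ => integrable_finsetSum _ fun j _ =>
      h.integrable_linForm_sq_mul_sq _ _
  have i1 : Integrable (fun ω => 2 * S * ∑ i ∈ s, linForm z (b i) ω ^ 2) P :=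
    (integrable_finsetSum _ fun i _ => h.integrable_linForm_pow _ 2).const_mul _
  have i0 : Integrable (fun ω => ∑ i ∈ s, ∑ j ∈ s,
      linForm z (b i) ω ^ 2 * linForm z (b j) ω ^ 2 -
        2 * S * ∑ i ∈ s, linForm z (b i) ω ^ 2) P := i2.sub i1
  rw [← ofReal_integral_eq_lintegral_ofReal]
  rotate_left
  · simp_rw [e1]; exact i0.add (integrable_const _)
  · exact Filter.Eventually.of_forall fun ω => sq_nonneg _
  apply ENNReal.ofReal_le_ofReal
  simp_rw [e1]
  rw [integral_add i0 (integrable_const _), integral_sub i2 i1, integral_const_mul,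
    integral_finsetSum _ fun i _ => integrable_finsetSum _ fun j _ =>
      h.integrable_linForm_sq_mul_sq _ _, integral_finsetSum _ fun i _ =>
      h.integrable_linForm_pow _ 2]
  simp_rw [integral_finsetSum _ fun j _ => h.integrable_linForm_sq_mul_sq _ _,
    h.integral_linForm_sq, h.integral_linForm_sq_mul_sq, Finset.sum_add_distrib]
  rw [← Finset.sum_mul_sum]
  simp only [integral_const, probReal_univ, smul_eq_mul, one_mul]
  have c1 : ∑ i ∈ s, ∑ j ∈ s, 2 * (∑ a, b i a * b j a) ^ 2 ≤ 2 * (s.card : ℝ) := by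
    calc ∑ i ∈ s, ∑ j ∈ s, 2 * (∑ a, b i a * b j a) ^ 2 ≤ ∑ _i ∈ s, (2 : ℝ) :=
          Finset.sum_le_sum fun i hi => by
            rw [Finset.sum_eq_single_of_mem i hi fun j _ hji => by
              rw [hb.orth i j hji.symm]; ring]
            simp_rw [← sq]
            have h1 := hb.norm_le i
            have h0 : 0 ≤ ∑ a, b i a ^ 2 := Finset.sum_nonneg fun a _ => sq_nonneg _
            nlinarith
      _ = 2 * s.card := by simp [mul_comm]
  have c2 : ∑ i ∈ s, ∑ j ∈ s, (κ - 3) * ∑ a, b i a ^ 2 * b j a ^ 2 ≤ (κ - 3) * s.card := by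
    simp_rw [← Finset.mul_sum]
    have h3 : 0 ≤ κ - 3 := by linarith
    gcongr
    calc ∑ i ∈ s, ∑ j ∈ s, ∑ a, b i a ^ 2 * b j a ^ 2 =
          ∑ i ∈ s, ∑ a, b i a ^ 2 * ∑ j ∈ s, b j a ^ 2 := by
          refine Finset.sum_congr rfl fun i _ => ?_
          rw [Finset.sum_comm]
          simp_rw [Finset.mul_sum]
      _ ≤ ∑ i ∈ s, ∑ a, b i a ^ 2 := Finset.sum_le_sum fun i _ => Finset.sum_le_sum fun a _ =>
          mul_le_of_le_one_right (sq_nonneg _) (hb.sum_coord_sq_le s a)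
      _ ≤ ∑ _i ∈ s, (1 : ℝ) := Finset.sum_le_sum fun i _ => hb.norm_le i
      _ = s.card := by simp
  have e4 : (∑ i ∈ s, ∑ a, b i a ^ 2) = S := rfl
  rw [e4]
  linarith

end variance

section gramSchmidt
open InnerProductSpace

lemma gramSchmidt_congr {ι E : Type*} [NormedAddCommGroup E] [InnerProductSpace ℝ E]
    [LinearOrder ι] [LocallyFiniteOrderBot ι] [WellFoundedLT ι] {f g : ι → E} (i : ι)
    (h : ∀ j ≤ i, f j = g j) : gramSchmidt ℝ f i = gramSchmidt ℝ g i := by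
  induction i using WellFoundedLT.induction with
  | _ i ih =>
    rw [gramSchmidt_def, gramSchmidt_def, h i le_rfl]
    congr 1
    refine Finset.sum_congr rfl fun j hj => ?_
    have hj' := Finset.mem_Iio.1 hj
    rw [ih j hj' fun l hl => h l (hl.trans hj'.le)]

lemma measurable_gramSchmidtNormed {ι α E : Type*} [NormedAddCommGroup E] [InnerProductSpace ℝ E]
    [MeasurableSpace E] [BorelSpace E] [SecondCountableTopology E] [MeasurableSpace α]
    [LinearOrder ι] [LocallyFiniteOrderBot ι] [WellFoundedLT ι] {f : α → ι → E}
    (hf : ∀ i, Measurable fun y => f y i) (i : ι) :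
    Measurable fun y => gramSchmidtNormed ℝ (f y) i := by
  have key : Measurable fun y => gramSchmidt ℝ (f y) i := by
    induction i using WellFoundedLT.induction with
    | _ i ih =>
      have e : (fun y => gramSchmidt ℝ (f y) i) = fun y => f y i - ∑ j ∈ Finset.Iio i,
          (inner ℝ (gramSchmidt ℝ (f y) j) (f y i) / ‖gramSchmidt ℝ (f y) j‖ ^ 2) •
            gramSchmidt ℝ (f y) j := by
        funext y
        rw [gramSchmidt_def]
        simp_rw [Submodule.starProjection_singleton]
        rfl
      rw [e]
      refine (hf i).sub (Finset.measurable_sum _ fun j hj => ?_)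
      have hj' := ih j (Finset.mem_Iio.1 hj)
      have hi := hf i
      exact ((hj'.inner hi).div (by fun_prop)).smul hj'
  unfold gramSchmidtNormed
  exact Measurable.smul (by simp; fun_prop) key

/-- Averaging over one of two independent variables while the other is fixed. -/
lemma lintegral_le_of_indepFun {α β : Type*} [MeasurableSpace α] [MeasurableSpace β]
    [IsProbabilityMeasure P] {Y : Ω → α} {X : Ω → β} (hY : Measurable Y) (hX : Measurable X)
    (hi : IndepFun Y X P) {g : α × β → ENNReal} (hg : Measurable g) {C : ENNReal}
    (hC : ∀ y, ∫⁻ ω, g (y, X ω) ∂P ≤ C) : ∫⁻ ω, g (Y ω, X ω) ∂P ≤ C := by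
  have := Measure.isProbabilityMeasure_map (μ := P) hX.aemeasurable
  have := Measure.isProbabilityMeasure_map (μ := P) hY.aemeasurable
  rw [← lintegral_map hg (hY.prodMk hX),
    (indepFun_iff_map_prod_eq_prod_map_map hY.aemeasurable hX.aemeasurable).1 hi,
    lintegral_prod _ hg.aemeasurable]
  calc _ ≤ ∫⁻ _y, C ∂(P.map Y) := lintegral_mono fun y => by
        rw [lintegral_map (by fun_prop) hX]; exact hC y
    _ = C := by simp

end gramSchmidt

end

/-! ### Lower bound on the objective by Gram-Schmidt -/

section

variable {Ω : Type*} [MeasurableSpace Ω] {P : Measure Ω} {c : ℝ≥0} {κ : ℝ}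

section gramSchmidt
open InnerProductSpace
variable {k : ℕ}

/-- The rows of a square array, as Euclidean vectors. -/
noncomputable def rowVectors (w : Fin k × Fin k → ℝ) (i : Fin k) : EuclideanSpace ℝ (Fin k) :=
  WithLp.toLp 2 fun l => w (i, l)

/-- The normalized Gram-Schmidt vectors of the rows of a square array, in coordinates. The vector
vanishes when the row depends linearly on the earlier ones. -/
noncomputable def gsRows (w : Fin k × Fin k → ℝ) (j a : Fin k) : ℝ :=
  gramSchmidtNormed ℝ (rowVectors w) j a

/-- The sum over the rows of the squared deviations of two quantities from their means given the
earlier rows: the squared length of the row, and that of its projection onto the span of the earlier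
rows. -/
noncomputable def gsDeviation (w : Fin k × Fin k → ℝ) : ℝ :=
  ∑ i, ((∑ j ∈ Finset.Iio i, (∑ a, gsRows w j a * w (i, a)) ^ 2 -
    ∑ j ∈ Finset.Iio i, ∑ a, gsRows w j a ^ 2) ^ 2 + (∑ a, w (i, a) ^ 2 - k) ^ 2)

lemma euclidean_inner (x y : EuclideanSpace ℝ (Fin k)) : inner ℝ x y = ∑ a, x a * y a := by
  rw [PiLp.inner_apply]
  exact Finset.sum_congr rfl fun a _ => by simp [mul_comm]

lemma isSubOrthonormal_gsRows (w : Fin k × Fin k → ℝ) : IsSubOrthonormal (gsRows w) where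
  orth i j hij := by
    have := gramSchmidt_orthogonal ℝ (rowVectors w) hij
    have h : inner ℝ (gramSchmidtNormed ℝ (rowVectors w) i)
        (gramSchmidtNormed ℝ (rowVectors w) j) = 0 := by
      simp [gramSchmidtNormed, inner_smul_left, inner_smul_right, this]
    rwa [euclidean_inner] at h
  norm_le i := by
    have h : inner ℝ (gramSchmidtNormed ℝ (rowVectors w) i)
        (gramSchmidtNormed ℝ (rowVectors w) i) ≤ 1 := by
      by_cases h0 : gramSchmidtNormed ℝ (rowVectors w) i = 0
      · rw [h0]; simp
      · rw [real_inner_self_eq_norm_sq, gramSchmidtNormed_unit_length' h0]; norm_num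
    rw [euclidean_inner] at h
    simpa only [sq] using! h

lemma measurable_gsRows (j a : Fin k) : Measurable fun w : Fin k × Fin k → ℝ => gsRows w j a := by
  have h : Measurable fun w : Fin k × Fin k → ℝ => gramSchmidtNormed ℝ (rowVectors w) j :=
    measurable_gramSchmidtNormed (fun i => by unfold rowVectors; fun_prop) j
  unfold gsRows
  fun_prop

lemma gsRows_congr {w w' : Fin k × Fin k → ℝ} {j : Fin k} (h : ∀ i ≤ j, ∀ l, w (i, l) = w' (i, l)) :
    gsRows w j = gsRows w' j := by
  have : gramSchmidt ℝ (rowVectors w) j = gramSchmidt ℝ (rowVectors w') j :=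
    gramSchmidt_congr j fun i hi => by
      unfold rowVectors
      congr 1
      funext l
      exact h i hi l
  funext a
  simp only [gsRows, gramSchmidtNormed, this]

variable {z : Fin k × Fin k → Ω → ℝ} [IsProbabilityMeasure P]

/-- The row `i` is independent of the Gram-Schmidt vectors of the earlier rows, so the variance
bound for projections onto fixed subspaces applies conditionally. -/
lemma IsFactorVector.lintegral_gs_projection_le (h : IsFactorVector P c κ z) (hκ : 3 ≤ κ)
    (i : Fin k) :
    ∫⁻ ω, ENNReal.ofReal ((∑ j ∈ Finset.Iio i, (∑ a, gsRows (fun p => z p ω) j a * z (i, a) ω) ^ 2 -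
      ∑ j ∈ Finset.Iio i, ∑ a, gsRows (fun p => z p ω) j a ^ 2) ^ 2) ∂P ≤
    ENNReal.ofReal ((κ - 1) * k) := by
  classical
  set S : Finset (Fin k × Fin k) := Finset.univ.filter fun p => p.1 ≠ i
  set T : Finset (Fin k × Fin k) := Finset.univ.filter fun p => p.1 = i
  have hST : Disjoint S T := by
    rw [Finset.disjoint_left]
    intro p hp hp'
    exact (Finset.mem_filter.1 hp).2 (Finset.mem_filter.1 hp').2
  have hind := h.indep.indepFun_finset S T hST h.meas
  have hT : ∀ l, (i, l) ∈ T := fun l => Finset.mem_filter.2 ⟨Finset.mem_univ _, rfl⟩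
  set Y : Ω → Fin k × Fin k → ℝ := fun ω p => if p ∈ S then z p ω else 0
  set X : Ω → Fin k → ℝ := fun ω l => z (i, l) ω
  have hYm : Measurable Y := by
    refine measurable_pi_lambda _ fun p => ?_
    simp only [Y]
    split_ifs
    · exact h.meas p
    · exact measurable_const
  have hXm : Measurable X := measurable_pi_lambda _ fun l => h.meas _
  have hYX : IndepFun Y X P := by
    have := hind.comp (φ := fun y p => if hp : p ∈ S then y ⟨p, hp⟩ else (0 : ℝ))
      (ψ := fun x l => x ⟨(i, l), hT l⟩)
      (measurable_pi_lambda _ fun p => by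
        by_cases hp : p ∈ S
        · simp only [hp, dif_pos]; fun_prop
        · simp only [hp, dif_neg, not_false_eq_true]; fun_prop) (by fun_prop)
    convert this using 1
    · funext ω p
      simp [Y]
    · rfl
  set g : (Fin k × Fin k → ℝ) × (Fin k → ℝ) → ENNReal := fun q =>
    ENNReal.ofReal ((∑ j ∈ Finset.Iio i, (∑ a, gsRows q.1 j a * q.2 a) ^ 2 -
      ∑ j ∈ Finset.Iio i, ∑ a, gsRows q.1 j a ^ 2) ^ 2)
  have hg : Measurable g := by
    have hgs : ∀ j a, Measurable fun q : (Fin k × Fin k → ℝ) × (Fin k → ℝ) => gsRows q.1 j a :=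
      fun j a => (measurable_gsRows j a).comp measurable_fst
    simp only [g]
    fun_prop
  have key := lintegral_le_of_indepFun hYm hXm hYX hg (C := ENNReal.ofReal ((κ - 1) * k))
    fun y => ((h.row i).variance_projection_le hκ (isSubOrthonormal_gsRows y)
      (Finset.Iio i)).trans (ENNReal.ofReal_le_ofReal (by
        have h1 : 0 ≤ κ - 1 := by linarith
        have h2 : (Finset.Iio i).card ≤ k := (Finset.card_le_univ _).trans (by simp)
        gcongr))
  refine le_trans (le_of_eq (lintegral_congr fun ω => ?_)) key
  have hc : ∀ j ∈ Finset.Iio i, gsRows (fun p => z p ω) j = gsRows (Y ω) j := fun j hj =>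
    gsRows_congr fun i' hi' l => by
      have : i' ≠ i := (lt_of_le_of_lt hi' (Finset.mem_Iio.1 hj)).ne
      simp [Y, S, this]
  simp only [g, X]
  congr 3
  · exact Finset.sum_congr rfl fun j hj => by rw [hc j hj]
  · exact Finset.sum_congr rfl fun j hj => by rw [hc j hj]

lemma measurable_gsDeviation : Measurable (gsDeviation (k := k)) := by
  have := measurable_gsRows (k := k)
  unfold gsDeviation
  fun_prop

lemma IsFactorVector.lintegral_gsDeviation_le (h : IsFactorVector P c κ z) (hκ : 3 ≤ κ) :
    ∫⁻ ω, ENNReal.ofReal (gsDeviation fun p => z p ω) ∂P ≤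
      ENNReal.ofReal (2 * (κ - 1) * k ^ 2) := by
  have hm := h.meas
  have h1 : 0 ≤ κ - 1 := by linarith
  have hrow : ∀ i, ∫⁻ ω, ENNReal.ofReal ((∑ a, z (i, a) ω ^ 2 - k) ^ 2) ∂P ≤
      ENNReal.ofReal ((κ - 1) * k) := by
    intro i
    have hb : IsSubOrthonormal (fun j : Fin k => (Pi.single j 1 : Fin k → ℝ)) :=
      ⟨fun i j hij => by simp [Pi.single_apply, hij.symm], fun i => by simp [Pi.single_apply]⟩
    have := (h.row i).variance_projection_le hκ hb Finset.univ
    simpa [linForm, Pi.single_apply] using this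
  have hgs := fun i => h.lintegral_gs_projection_le hκ i
  unfold gsDeviation
  simp_rw [ENNReal.ofReal_sum_of_nonneg (fun i _ => add_nonneg (sq_nonneg _) (sq_nonneg _)),
    ENNReal.ofReal_add (sq_nonneg _) (sq_nonneg _)]
  have hmgs : ∀ j a, Measurable fun ω => gsRows (fun p => z p ω) j a := fun j a =>
    (measurable_gsRows j a).comp (measurable_pi_lambda _ hm)
  rw [lintegral_finsetSum _ fun i _ => by fun_prop]
  calc _ ≤ ∑ _i : Fin k, (ENNReal.ofReal ((κ - 1) * k) + ENNReal.ofReal ((κ - 1) * k)) := by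
        refine Finset.sum_le_sum fun i _ => ?_
        rw [lintegral_add_right _ (by fun_prop)]
        exact add_le_add (hgs i) (hrow i)
    _ = _ := by
        rw [← ENNReal.ofReal_add (by positivity) (by positivity), Finset.sum_const,
          Finset.card_univ, Fintype.card_fin, ← ENNReal.ofReal_nsmul]
        congr 1
        rw [nsmul_eq_mul]; ring

lemma IsFactorVector.prob_gsDeviation_ge (h : IsFactorVector P c κ z) (hκ : 3 ≤ κ) {t : ℝ}
    (ht : 0 < t) : P.real {ω | t ≤ gsDeviation fun p => z p ω} ≤ 2 * (κ - 1) * k ^ 2 / t := by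
  have hm := h.meas
  have hg : Measurable fun ω => gsDeviation fun p => z p ω :=
    measurable_gsDeviation.comp (measurable_pi_lambda _ hm)
  have h1 : 0 ≤ κ - 1 := by linarith
  have h2 := (mul_meas_ge_le_lintegral (μ := P) (f := fun ω => ENNReal.ofReal
    (gsDeviation fun p => z p ω)) (by fun_prop) (ENNReal.ofReal t)).trans
    (h.lintegral_gsDeviation_le hκ)
  have h3 : {ω | t ≤ gsDeviation fun p => z p ω} ⊆
      {ω | ENNReal.ofReal t ≤ ENNReal.ofReal (gsDeviation fun p => z p ω)} := fun ω hω =>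
    ENNReal.ofReal_le_ofReal hω
  have h4 := (mul_le_mul_right (measure_mono h3) (ENNReal.ofReal t)).trans h2
  have h5 := ENNReal.toReal_mono (by simp) h4
  rw [ENNReal.toReal_mul, ENNReal.toReal_ofReal ht.le, ENNReal.toReal_ofReal (by positivity)] at h5
  rw [le_div_iff₀ ht, mul_comm]
  exact h5

omit [MeasurableSpace Ω] in
/-- Aligning the `j`-th row of an orthogonal matrix with the part of the `j`-th data row orthogonal
to the previous ones makes the objective at least of order `k ^ 3 / 3`. -/
lemma IsVarimax.objective_ge {n : ℕ} (hk : 1 ≤ k) (hkn : k ≤ n) {Z : Matrix (Fin n) (Fin k) ℝ}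
    {V : Matrix (Fin k) (Fin k) ℝ} (hV : IsVarimax Z V) :
    (k : ℝ) ^ 3 / 3 - 2 * k ^ 2 * √k -
      √k * gsDeviation (fun p : Fin k × Fin k => Z (Fin.castLE hkn p.1) p.2) ≤
      varimaxObjective Z V := by
  set w : Fin k × Fin k → ℝ := fun p => Z (Fin.castLE hkn p.1) p.2
  set f := rowVectors w
  set OB := gramSchmidtOrthonormalBasis (𝕜 := ℝ) (by simp) f
  set Q : Matrix (Fin k) (Fin k) ℝ := Matrix.of fun j l => OB j l
  have hQ : Q ∈ Matrix.orthogonalGroup (Fin k) ℝ := by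
    rw [Matrix.mem_orthogonalGroup_iff]
    ext i j
    have := orthonormal_iff_ite.1 OB.orthonormal i j
    rw [euclidean_inner] at this
    simpa [Matrix.mul_apply, Q, Matrix.one_apply] using this
  refine le_trans ?_ (hV.2 Q hQ)
  set D : Fin k → ℝ := fun j => inner ℝ (OB j) (f j) ^ 2
  have h1 : ∑ j, D j ^ 2 ≤ varimaxObjective Z Q := by
    rw [varimaxObjective_eq]
    refine Finset.sum_le_sum fun j _ => ?_
    have e : D j ^ 2 = (∑ l, Q j l * Z (Fin.castLE hkn j) l) ^ 4 := by
      simp only [D]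
      rw [euclidean_inner, ← pow_mul]
      rfl
    rw [e]
    exact Finset.single_le_sum (f := fun i => (∑ l, Q j l * Z i l) ^ 4)
      (fun i _ => by positivity) (Finset.mem_univ _)
  refine le_trans ?_ h1
  set A : Fin k → ℝ := fun i => ∑ j ∈ Finset.Iio i, (∑ a, gsRows w j a * w (i, a)) ^ 2
  set S : Fin k → ℝ := fun i => ∑ j ∈ Finset.Iio i, ∑ a, gsRows w j a ^ 2
  set N : Fin k → ℝ := fun i => ∑ a, w (i, a) ^ 2
  have hD : ∀ i, D i = N i - A i := by
    intro i
    have e1 : N i = ∑ j, inner ℝ (OB j) (f i) ^ 2 := by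
      have := OB.sum_sq_norm_inner_right (f i)
      simp only [Real.norm_eq_abs, sq_abs] at this
      rw [this, ← real_inner_self_eq_norm_sq, euclidean_inner]
      exact Finset.sum_congr rfl fun a _ => sq _
    have e2 : ∑ j, inner ℝ (OB j) (f i) ^ 2 = ∑ j ∈ Finset.Iic i, inner ℝ (OB j) (f i) ^ 2 := by
      refine (Finset.sum_subset (Finset.subset_univ _) fun j _ hj => ?_).symm
      have hij : i < j := by simpa using hj
      rw [gramSchmidtOrthonormalBasis_inv_triangular _ _ hij]
      norm_num
    have e3 : A i = ∑ j ∈ Finset.Iio i, inner ℝ (OB j) (f i) ^ 2 := by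
      refine Finset.sum_congr rfl fun j _ => ?_
      have : ∑ a, gsRows w j a * w (i, a) = inner ℝ (gramSchmidtNormed ℝ f j) (f i) := by
        rw [euclidean_inner]; rfl
      rw [this]
      by_cases h0 : gramSchmidtNormed ℝ f j = 0
      · rw [h0, inner_gramSchmidtOrthonormalBasis_eq_zero _ h0]; simp
      · rw [gramSchmidtOrthonormalBasis_apply _ h0]
    rw [e1, e2, e3, ← Finset.Iio_insert, Finset.sum_insert (by simp)]
    ring
  have hS : ∀ i : Fin k, S i ≤ i := by
    intro i
    calc S i ≤ ∑ _j ∈ Finset.Iio i, (1 : ℝ) := Finset.sum_le_sum fun j _ =>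
          (isSubOrthonormal_gsRows w).norm_le j
      _ = i := by simp
  have hk0 : (0 : ℝ) < k := by exact_mod_cast hk
  have hsk : 0 < √(k : ℝ) := Real.sqrt_pos.2 hk0
  have hss : √(k : ℝ) * √k = k := Real.mul_self_sqrt hk0.le
  -- the tangent line inequality `D ^ 2 ≥ a ^ 2 + 2 a (D - a)` at `a = k - i`
  have hterm : ∀ i : Fin k, ((k : ℝ) - i) ^ 2 - 2 * k * √k -
      √k * ((A i - S i) ^ 2 + (N i - k) ^ 2) ≤ D i ^ 2 := by
    intro i
    have hi : (i : ℝ) ≤ k := by exact_mod_cast i.2.le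
    have hi0 : (0 : ℝ) ≤ i := by positivity
    set a : ℝ := k - i
    have ha0 : 0 ≤ a := by simp only [a]; linarith
    have hak : a ≤ k := by simp only [a]; linarith
    have young : ∀ y : ℝ, 2 * k * |y| ≤ √k * y ^ 2 + k * √k := by
      intro y
      have h5 : 0 ≤ √(k : ℝ) * (|y| - √k) ^ 2 := by positivity
      have h6 : √(k : ℝ) * (|y| - √k) ^ 2 =
          √k * y ^ 2 - 2 * (√k * √k) * |y| + (√k * √k) * √k := by
        rw [← sq_abs y]; ring
      rw [hss] at h6
      linarith
    have h7 := young (A i - S i)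
    have h8 := young (N i - k)
    have h9 : a - |A i - S i| - |N i - k| ≤ D i := by
      rw [hD]
      have := hS i
      have := le_abs_self (A i - S i)
      have := neg_abs_le (N i - k)
      simp only [a]
      linarith
    have h10 : a ^ 2 + 2 * a * (D i - a) ≤ D i ^ 2 := by nlinarith [sq_nonneg (D i - a)]
    have h11 : 2 * a * (|A i - S i| + |N i - k|) ≤ 2 * k * (|A i - S i| + |N i - k|) := by
      gcongr
    have h12 : 2 * a * (a - |A i - S i| - |N i - k|) ≤ 2 * a * D i := by gcongr
    linarith
  have hsum := Finset.sum_le_sum fun i (_ : i ∈ Finset.univ) => hterm i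
  refine le_trans ?_ hsum
  simp only [Finset.sum_sub_distrib, ← Finset.mul_sum]
  have hsq : (k : ℝ) ^ 3 / 3 ≤ ∑ i : Fin k, ((k : ℝ) - i) ^ 2 := by
    rw [Fin.sum_univ_eq_sum_range (fun i => ((k : ℝ) - i) ^ 2) k]
    have : ∀ m : ℕ, m ≤ k →
        (k : ℝ) ^ 3 - (k - m) ^ 3 ≤ 3 * ∑ i ∈ Finset.range m, ((k : ℝ) - i) ^ 2 := by
      intro m
      induction m with
      | zero => simp
      | succ m ih =>
        intro hm
        have h5 := ih (by omega)
        rw [Finset.sum_range_succ]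
        push_cast
        have : (m : ℝ) + 1 ≤ k := by exact_mod_cast hm
        nlinarith
    have h := this k le_rfl
    simp at h
    linarith
  have e : gsDeviation w = ∑ i, ((A i - S i) ^ 2 + (N i - k) ^ 2) := rfl
  rw [e]
  simp only [Finset.sum_const, Finset.card_univ, Fintype.card_fin, nsmul_eq_mul]
  linarith

end gramSchmidt

end

/-! ### Upper bound on the objective near signed permutations -/

section

section deterministic
variable {n k : ℕ} {Z : Matrix (Fin n) (Fin k) ℝ}

/-- A row of a signed permutation matrix selects a single entry, up to sign. -/
lemma signedPermutation_row_pow_four {Q : Matrix (Fin k) (Fin k) ℝ} (hQ : Q ∈ signedPermutations k)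
    (j : Fin k) (x : Fin k → ℝ) : (∑ l, Q j l * x l) ^ 4 = ∑ l, Q j l ^ 2 * x l ^ 4 := by
  have hrow := sum_row_sq hQ.1 j
  obtain ⟨l₀, hl₀⟩ : ∃ l, Q j l ≠ 0 := by
    by_contra hcon
    push Not at hcon
    simp [hcon] at hrow
  have h1 : Q j l₀ ^ 2 = 1 := by
    rcases hQ.2 j l₀ with h | h | h
    · exact absurd h hl₀
    · rw [h]; norm_num
    · rw [h]; norm_num
  have h0 : ∀ l, l ≠ l₀ → Q j l = 0 := by
    intro l hl
    have : Q j l ^ 2 + Q j l₀ ^ 2 ≤ ∑ i, Q j i ^ 2 := by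
      rw [← Finset.sum_pair (f := fun i => Q j i ^ 2) hl]
      exact Finset.sum_le_sum_of_subset_of_nonneg (Finset.subset_univ _) fun i _ _ => sq_nonneg _
    rw [hrow, h1] at this
    exact pow_eq_zero_iff two_ne_zero |>.1 (le_antisymm (by linarith) (sq_nonneg _))
  rw [Finset.sum_eq_single l₀ (fun l _ hl => by rw [h0 l hl, zero_mul]) (by simp),
    Finset.sum_eq_single l₀ (fun l _ hl => by rw [h0 l hl]; ring) (by simp), mul_pow,
    show Q j l₀ ^ 4 = (Q j l₀ ^ 2) ^ 2 by ring, h1]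
  ring

lemma add_pow_four_le (x y : ℝ) : (x + y) ^ 4 ≤ (21 / 20) ^ 3 * x ^ 4 + 21 ^ 3 * y ^ 4 := by
  -- convexity of the fourth power, with weights `20 / 21` and `1 / 21`
  have hc : ConvexOn ℝ Set.univ (fun x : ℝ => x ^ 4) := Even.convexOn_pow (by decide)
  have h := hc.2 (Set.mem_univ (21 / 20 * x)) (Set.mem_univ (21 * y))
    (by norm_num : (0 : ℝ) ≤ 20 / 21) (by norm_num : (0 : ℝ) ≤ 1 / 21) (by norm_num)
  simp only [smul_eq_mul] at h
  have e : 20 / 21 * (21 / 20 * x) + 1 / 21 * (21 * y) = x + y := by ring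
  rw [e] at h
  nlinarith

/-- A row of `V` close to the matching row `p` of a signed permutation splits into a multiple `t p`
and an orthogonal part of squared length `1 - t ^ 2`; summing `(1 - t ^ 2) ^ 2 ≤ 32 / 27 (1 - t)`
over the rows bounds the objective. -/
lemma objective_le_of_near_signedPermutation {V Q : Matrix (Fin k) (Fin k) ℝ} {A : ℝ}
    (hV : V ∈ Matrix.orthogonalGroup (Fin k) ℝ) (hQ : Q ∈ signedPermutations k)
    (hVQ : ∑ i, ∑ j, (V i j - Q i j) ^ 2 ≤ k / 4)
    (hA : ∀ u : Fin k → ℝ, ∑ l, u l ^ 2 ≤ 1 → ∑ i, (∑ l, u l * Z i l) ^ 4 ≤ A) :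
    varimaxObjective Z V ≤ (21 / 20) ^ 3 * (4 / 27 * k * A) + 21 ^ 3 * ∑ i, ∑ j, Z i j ^ 4 := by
  have hA0 : 0 ≤ A := by simpa using hA 0 (by simp)
  have hscale : ∀ w : Fin k → ℝ, ∑ i, (∑ l, w l * Z i l) ^ 4 ≤ (∑ l, w l ^ 2) ^ 2 * A := by
    intro w
    have hs0 : 0 ≤ ∑ l, w l ^ 2 := Finset.sum_nonneg fun l _ => sq_nonneg _
    rcases hs0.eq_or_lt with hs | hs
    · have hw : ∀ l, w l = 0 := fun l => by
        have := (Finset.sum_eq_zero_iff_of_nonneg fun l _ => sq_nonneg (w l)).1 hs.symm l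
          (Finset.mem_univ l)
        exact pow_eq_zero_iff two_ne_zero |>.1 this
      simp [hw]
    · set s := ∑ l, w l ^ 2
      have hr : 0 < √s := Real.sqrt_pos.2 hs
      have hrr : √s ^ 2 = s := Real.sq_sqrt hs.le
      have h1 := hA (fun l => w l / √s) (by
        simp_rw [div_pow, hrr, ← Finset.sum_div]
        exact (div_self hs.ne').le)
      have h2 : ∀ i, (∑ l, w l / √s * Z i l) ^ 4 = (∑ l, w l * Z i l) ^ 4 / s ^ 2 := by
        intro i
        have : ∑ l, w l / √s * Z i l = (∑ l, w l * Z i l) / √s := by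
          rw [Finset.sum_div]
          exact Finset.sum_congr rfl fun l _ => by ring
        rw [this, div_pow, show √s ^ 4 = (√s ^ 2) ^ 2 by ring, hrr]
      simp_rw [h2, ← Finset.sum_div] at h1
      rw [div_le_iff₀ (by positivity)] at h1
      linarith
  set t : Fin k → ℝ := fun j => ∑ l, V j l * Q j l
  have hdist : ∀ j, ∑ l, (V j l - Q j l) ^ 2 = 2 - 2 * t j := by
    intro j
    have : ∀ l, (V j l - Q j l) ^ 2 = V j l ^ 2 + Q j l ^ 2 - 2 * (V j l * Q j l) := fun l => by
      ring
    simp_rw [this, Finset.sum_sub_distrib, Finset.sum_add_distrib, sum_row_sq hV, sum_row_sq hQ.1,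
      ← Finset.mul_sum]
    simp only [t]; ring
  have ht1 : ∀ j, t j ^ 2 ≤ 1 := fun j => by
    have := Finset.sum_mul_sq_le_sq_mul_sq Finset.univ (V j) (Q j)
    rw [sum_row_sq hV, sum_row_sq hQ.1] at this
    simpa using this
  have hrow : ∀ j, ∑ i, (∑ l, V j l * Z i l) ^ 4 ≤
      (21 / 20) ^ 3 * (32 / 27 * (1 - t j) * A) + 21 ^ 3 * ∑ i, ∑ l, Q j l ^ 2 * Z i l ^ 4 := by
    intro j
    set w : Fin k → ℝ := fun l => V j l - t j * Q j l
    have hw : ∑ l, w l ^ 2 = 1 - t j ^ 2 := by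
      have : ∀ l, w l ^ 2 = V j l ^ 2 + t j ^ 2 * Q j l ^ 2 - 2 * t j * (V j l * Q j l) :=
        fun l => by simp only [w]; ring
      simp_rw [this, Finset.sum_sub_distrib, Finset.sum_add_distrib, ← Finset.mul_sum,
        sum_row_sq hV, sum_row_sq hQ.1]
      simp only [t]; ring
    have hsplit : ∀ i, (∑ l, V j l * Z i l) ^ 4 ≤ (21 / 20) ^ 3 * (∑ l, w l * Z i l) ^ 4 +
        21 ^ 3 * ∑ l, Q j l ^ 2 * Z i l ^ 4 := by
      intro i
      have e : ∑ l, V j l * Z i l = ∑ l, w l * Z i l + t j * ∑ l, Q j l * Z i l := by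
        rw [Finset.mul_sum, ← Finset.sum_add_distrib]
        exact Finset.sum_congr rfl fun l _ => by simp only [w]; ring
      rw [e, ← signedPermutation_row_pow_four hQ j]
      refine (add_pow_four_le _ _).trans ?_
      have h4 : t j ^ 4 ≤ 1 := by
        rw [show t j ^ 4 = (t j ^ 2) ^ 2 by ring]
        exact pow_le_one₀ (sq_nonneg _) (ht1 j)
      rw [mul_pow (t j)]
      have h5 : t j ^ 4 * (∑ l, Q j l * Z i l) ^ 4 ≤ (∑ l, Q j l * Z i l) ^ 4 :=
        mul_le_of_le_one_left (by positivity) h4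
      linarith
    refine (Finset.sum_le_sum fun i _ => hsplit i).trans ?_
    rw [Finset.sum_add_distrib, ← Finset.mul_sum, ← Finset.mul_sum]
    have h6 := hscale w
    rw [hw] at h6
    have h7 : (1 - t j ^ 2) ^ 2 ≤ 32 / 27 * (1 - t j) := by
      -- `32 / 27 - x (2 - x) ^ 2 = (x - 2 / 3) ^ 2 (8 / 3 - x)` with `x = 1 - t`
      obtain ⟨h8, h9⟩ := abs_le.1 ((sq_le_one_iff_abs_le_one _).1 (ht1 j))
      have : 0 ≤ (1 - t j) * ((1 - t j - 2 / 3) ^ 2 * (8 / 3 - (1 - t j))) :=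
        mul_nonneg (by linarith) (mul_nonneg (sq_nonneg _) (by linarith))
      nlinarith
    have h10 := mul_le_mul_of_nonneg_right h7 hA0
    linarith
  rw [varimaxObjective_eq]
  refine (Finset.sum_le_sum fun j _ => hrow j).trans ?_
  rw [Finset.sum_add_distrib, ← Finset.mul_sum, ← Finset.mul_sum]
  have h1 : ∑ j, ∑ i, ∑ l, Q j l ^ 2 * Z i l ^ 4 = ∑ i, ∑ l, Z i l ^ 4 := by
    rw [Finset.sum_comm]
    refine Finset.sum_congr rfl fun i _ => ?_
    rw [Finset.sum_comm]
    refine Finset.sum_congr rfl fun l _ => ?_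
    rw [← Finset.sum_mul, sum_col_sq hQ.1, one_mul]
  have h2 : ∑ j, 32 / 27 * (1 - t j) * A ≤ 4 / 27 * k * A := by
    rw [← Finset.sum_mul, ← Finset.mul_sum]
    have h3 : ∑ j, (1 - t j) ≤ k / 8 := by
      simp_rw [hdist] at hVQ
      have : ∑ j, (2 - 2 * t j) = 2 * ∑ j, (1 - t j) := by
        rw [Finset.mul_sum]
        exact Finset.sum_congr rfl fun j _ => by ring
      linarith
    exact mul_le_mul_of_nonneg_right (by linarith) hA0
  rw [h1]
  linarith

/-- Sums of squares over sparse sets of rows, from the same bound on a grid of sparse vectors. -/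
lemma sum_sq_le_of_sparse_grid (hn : 1 ≤ n) (hkn : k ≤ n) (hk : 2000 ≤ k)
    (hZ : ∀ i j, |Z i j| ≤ n) {I : Finset (Fin n)}
    (hI : ∀ x ∈ gridVectors (n ^ 10) I, ∑ i, x i ^ 2 ≤ 1 →
      ∑ l, (∑ i, x i * Z i l) ^ 2 ≤ 21 / 20 * k)
    {u : Fin k → ℝ} (hu : ∑ l, u l ^ 2 ≤ 1) :
    ∑ i ∈ I, (∑ l, u l * Z i l) ^ 2 ≤ 11 / 10 * k := by
  have hn1 : (1 : ℝ) ≤ n := by exact_mod_cast hn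
  have hk' : (2000 : ℝ) ≤ k := by exact_mod_cast hk
  have hkn' : (k : ℝ) ≤ n := by exact_mod_cast hkn
  set X : Fin n → ℝ := fun i => ∑ l, u l * Z i l
  set q := ∑ i ∈ I, X i ^ 2
  have hq0 : 0 ≤ q := Finset.sum_nonneg fun i _ => sq_nonneg _
  rcases hq0.eq_or_lt with h0 | hq
  · rw [← h0]; positivity
  have hs : 0 < √q := Real.sqrt_pos.2 hq
  have hss : √q ^ 2 = q := Real.sq_sqrt hq.le
  set y : Fin n → ℝ := fun i => if i ∈ I then X i / √q else 0
  have hy2 : ∑ i, y i ^ 2 = 1 := by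
    have : ∀ i, y i ^ 2 = if i ∈ I then X i ^ 2 / q else 0 := fun i => by
      simp only [y]
      split_ifs
      · rw [div_pow, hss]
      · norm_num
    simp_rw [this, Finset.sum_ite_mem, Finset.univ_inter, ← Finset.sum_div]
    exact div_self hq.ne'
  have hy1 : ∀ i, |y i| ≤ 1 := fun i => by
    rw [← sq_le_one_iff₀ (abs_nonneg _), sq_abs, ← hy2]
    exact Finset.single_le_sum (f := fun i => y i ^ 2) (fun _ _ => sq_nonneg _)
      (Finset.mem_univ i)
  obtain ⟨v, hv, hvy⟩ := exists_gridVector (M := n ^ 10) (by positivity) hy1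
    (I := I) (fun i hi => by simp [y, hi])
  have hv2 : ∑ i, v i ^ 2 ≤ 1 := by
    rw [← hy2]
    exact Finset.sum_le_sum fun i _ => sq_le_sq.2 (hvy i).1
  have hgrid := hI v hv hv2
  have hd : ∀ l, |∑ i, y i * Z i l - ∑ i, v i * Z i l| ≤ 1 / n ^ 8 := fun l =>
    (abs_pow_four_sub_le hn (by simp) (fun i => hZ i l) hy1
      (fun i => (hvy i).1.trans (hy1 i)) (fun i => (hvy i).2)).1
  have hu1 : ∀ l, |u l| ≤ 1 := fun l => by
    rw [← sq_le_one_iff₀ (abs_nonneg _), sq_abs]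
    exact (Finset.single_le_sum (f := fun l => u l ^ 2) (fun _ _ => sq_nonneg _)
      (Finset.mem_univ l)).trans hu
  have hsq : √q = ∑ l, u l * ∑ i, y i * Z i l := by
    have e1 : ∑ i, y i * X i = √q := by
      have : ∀ i, y i * X i = if i ∈ I then X i ^ 2 / √q else 0 := fun i => by
        simp only [y]
        split_ifs <;> ring
      simp_rw [this, Finset.sum_ite_mem, Finset.univ_inter, ← Finset.sum_div]
      rw [div_eq_iff hs.ne', ← sq, hss]
    rw [← e1]
    simp_rw [X, Finset.mul_sum]
    rw [Finset.sum_comm]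
    exact Finset.sum_congr rfl fun l _ => Finset.sum_congr rfl fun i _ => by ring
  have h1 : √q ≤ ∑ l, u l * ∑ i, v i * Z i l + 1 := by
    have h2 : √q - ∑ l, u l * ∑ i, v i * Z i l ≤ ∑ _l : Fin k, 1 / (n : ℝ) ^ 8 := by
      rw [hsq, ← Finset.sum_sub_distrib]
      refine Finset.sum_le_sum fun l _ => ?_
      rw [← mul_sub]
      refine (le_abs_self _).trans ?_
      rw [abs_mul]
      exact (mul_le_of_le_one_left (abs_nonneg _) (hu1 l)).trans (hd l)
    have h3 : ∑ _l : Fin k, 1 / (n : ℝ) ^ 8 ≤ 1 := by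
      simp only [Finset.sum_const, Finset.card_univ, Fintype.card_fin, nsmul_eq_mul]
      rw [mul_one_div, div_le_one (by positivity)]
      exact hkn'.trans (le_self_pow₀ hn1 (by norm_num))
    linarith
  set g := ∑ l, u l * ∑ i, v i * Z i l
  have hg : g ^ 2 ≤ 21 / 20 * k := by
    have := Finset.sum_mul_sq_le_sq_mul_sq Finset.univ u (fun l => ∑ i, v i * Z i l)
    refine this.trans ((mul_le_of_le_one_left ?_ hu).trans hgrid)
    exact Finset.sum_nonneg fun l _ => sq_nonneg _
  have h5 : q ≤ (g + 1) ^ 2 := by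
    rw [← hss]
    gcongr
  nlinarith [sq_nonneg (g - 50)]

/-- Uniform bound on the fourth moments: the few large values of `⟨u, z i⟩` are controlled by the
sparse bound, the others by the truncated sums on the grid. -/
lemma sum_pow_four_le_of_events (hn : 1 ≤ n) (hkn : k ≤ n) (hk : 2000 ≤ k)
    (hZ : ∀ i j, |Z i j| ≤ n) {m : ℕ} (hmn : m ≤ n) {B T : ℝ}
    (hmB : 11 / 10 * k < m * B)
    (hsparse : ∀ I : Finset (Fin n), I.card = m → ∀ x ∈ gridVectors (n ^ 10) I,
      ∑ i, x i ^ 2 ≤ 1 → ∑ l, (∑ i, x i * Z i l) ^ 2 ≤ 21 / 20 * k)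
    (hgrid : ∀ v ∈ gridVectors (n ^ 10) (Finset.univ : Finset (Fin k)), ∑ l, v l ^ 2 ≤ 1 →
      ∑ i, min ((∑ l, v l * Z i l) ^ 4) (B ^ 2) ≤ T)
    {u : Fin k → ℝ} (hu : ∑ l, u l ^ 2 ≤ 1) :
    ∑ i, (∑ l, u l * Z i l) ^ 4 ≤ 121 / 100 * k ^ 2 + T + 4 := by
  classical
  have hn1 : (1 : ℝ) ≤ n := by exact_mod_cast hn
  set X : Fin n → ℝ := fun i => ∑ l, u l * Z i l
  set H : Finset (Fin n) := Finset.univ.filter fun i => B < X i ^ 2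
  have hI : ∀ I : Finset (Fin n), I.card = m → ∑ i ∈ I, X i ^ 2 ≤ 11 / 10 * k := fun I hIm =>
    sum_sq_le_of_sparse_grid hn hkn hk hZ (hsparse I hIm) hu
  have hH : H.card ≤ m := by
    by_contra hcon
    obtain ⟨I, hIH, hIm⟩ := Finset.exists_subset_card_eq (not_le.1 hcon).le
    have h1 := hI I hIm
    have h2 : ∑ _i ∈ I, B ≤ ∑ i ∈ I, X i ^ 2 := Finset.sum_le_sum fun i hi =>
      (Finset.mem_filter.1 (hIH hi)).2.le
    rw [Finset.sum_const, hIm, nsmul_eq_mul] at h2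
    linarith
  obtain ⟨I, hHI, hIm⟩ := Finset.exists_superset_card_eq hH (by simpa using hmn)
  have hHsum : ∑ i ∈ H, X i ^ 2 ≤ 11 / 10 * k :=
    (Finset.sum_le_sum_of_subset_of_nonneg hHI fun i _ _ => sq_nonneg _).trans (hI I hIm)
  have hu1 : ∀ l, |u l| ≤ 1 := fun l => by
    rw [← sq_le_one_iff₀ (abs_nonneg _), sq_abs]
    exact (Finset.single_le_sum (f := fun l => u l ^ 2) (fun _ _ => sq_nonneg _)
      (Finset.mem_univ l)).trans hu
  obtain ⟨v, hv, hvu⟩ := exists_gridVector (M := n ^ 10) (by positivity) hu1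
    (I := Finset.univ) (by simp)
  have hv2 : ∑ l, v l ^ 2 ≤ 1 :=
    (Finset.sum_le_sum fun l _ => sq_le_sq.2 (hvu l).1).trans hu
  have hT := hgrid v hv hv2
  have hheavy : ∑ i ∈ H, X i ^ 4 ≤ 121 / 100 * k ^ 2 := by
    calc ∑ i ∈ H, X i ^ 4 = ∑ i ∈ H, (X i ^ 2) ^ 2 :=
          Finset.sum_congr rfl fun i _ => by ring
      _ ≤ (∑ i ∈ H, X i ^ 2) ^ 2 := Finset.sum_sq_le_sq_sum_of_nonneg fun i _ => sq_nonneg _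
      _ ≤ (11 / 10 * k) ^ 2 := by
          have : 0 ≤ ∑ i ∈ H, X i ^ 2 := Finset.sum_nonneg fun i _ => sq_nonneg _
          gcongr
      _ = _ := by ring
  have hlight : ∑ i ∈ Hᶜ, X i ^ 4 ≤ T + 4 := by
    calc ∑ i ∈ Hᶜ, X i ^ 4 = ∑ i ∈ Hᶜ, min (X i ^ 4) (B ^ 2) := by
          refine Finset.sum_congr rfl fun i hi => (min_eq_left ?_).symm
          have : X i ^ 2 ≤ B := by simpa [H] using hi
          calc X i ^ 4 = (X i ^ 2) ^ 2 := by ring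
            _ ≤ B ^ 2 := by gcongr
      _ ≤ ∑ i, min (X i ^ 4) (B ^ 2) :=
          Finset.sum_le_sum_of_subset_of_nonneg (Finset.subset_univ _) fun i _ _ =>
            le_min (by positivity) (by positivity)
      _ ≤ ∑ i, (min ((∑ l, v l * Z i l) ^ 4) (B ^ 2) + 4 / n ^ 2) := by
          refine Finset.sum_le_sum fun i _ => ?_
          have := (abs_pow_four_sub_le hn (by simpa using hkn) (hZ i) hu1
            (fun l => (hvu l).1.trans (hu1 l)) (fun l => (hvu l).2)).2
          have h1 := (abs_le.1 this).2
          have h0 : (0 : ℝ) ≤ 4 / n ^ 2 := by positivity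
          rw [← min_add_add_right]
          exact min_le_min (by linarith) (by linarith)
      _ ≤ T + 4 := by
          rw [Finset.sum_add_distrib]
          simp only [Finset.sum_const, Finset.card_univ, Fintype.card_fin, nsmul_eq_mul]
          have : (n : ℝ) * (4 / n ^ 2) ≤ 4 := by
            rw [mul_div_assoc', div_le_iff₀ (by positivity)]
            nlinarith
          linarith
  rw [← Finset.sum_add_sum_compl H]
  linarith

end deterministic

variable {Ω : Type*} [MeasurableSpace Ω] {P : Measure Ω} {c : ℝ≥0} {κ : ℝ}
  {n k : ℕ} {z : Fin n × Fin k → Ω → ℝ} [IsProbabilityMeasure P]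

/-- Uniform bound on the truncated fourth moments over the grid. -/
lemma IsFactorVector.prob_grid_truncated (h : IsFactorVector P c κ z) (hn : 3 ≤ n) (hk : 1 ≤ k)
    (hκ : 3 ≤ κ) {b : ℝ} (hb : 0 < b) :
    P.real {ω | ¬ ∀ v ∈ gridVectors (n ^ 10) (Finset.univ : Finset (Fin k)), ∑ l, v l ^ 2 ≤ 1 →
      ∑ i, min ((∑ l, v l * z (i, l) ω) ^ 4) b ≤
        n * (κ + eighthBound (sqRate c) / b) + 12 * b * (k * Real.log n)} ≤ 1 / n := by
  classical
  have hn0 : (0 : ℝ) < n := by positivity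
  have hk1 : (1 : ℝ) ≤ k := by exact_mod_cast hk
  set L := Real.log n with hL
  have hL0 : 0 ≤ L := Real.log_nonneg (by exact_mod_cast (by omega : 1 ≤ n))
  set s := n * (κ + eighthBound (sqRate c) / b) + 12 * b * (k * L)
  have hfix : ∀ v : Fin k → ℝ, ∑ l, v l ^ 2 ≤ 1 →
      P.real {ω | s ≤ ∑ i, min ((∑ l, v l * z (i, l) ω) ^ 4) b} ≤
        Real.exp (-(12 * k * L)) := by
    intro v hv
    have hm : 3 + (κ - 3) * ∑ l, v l ^ 4 ≤ κ := by
      have h1 : ∑ l, v l ^ 4 ≤ 1 := by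
        refine le_trans (Finset.sum_le_sum fun l _ => ?_) hv
        have : v l ^ 2 ≤ 1 := (Finset.single_le_sum (f := fun l => v l ^ 2)
          (fun _ _ => sq_nonneg _) (Finset.mem_univ l)).trans hv
        nlinarith [sq_nonneg (v l)]
      nlinarith
    refine (h.prob_truncated_le hv hb.le (l := 1 / b) (by positivity) (by field_simp; rfl) hm
      s).trans (Real.exp_le_exp.2 (le_of_eq ?_))
    simp only [Fintype.card_fin, s]
    field_simp
    ring
  set S := (gridVectors (n ^ 10) (Finset.univ : Finset (Fin k))).filter
    fun v => ∑ l, v l ^ 2 ≤ 1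
  have hS : (S.card : ℝ) ≤ Real.exp (11 * k * L) := by
    refine le_trans ?_ (card_grid_le_exp hn (Finset.univ : Finset (Fin k)) (by simp))
    exact_mod_cast Finset.card_filter_le _ _
  have hU := measureReal_biUnion_le_card_mul S (P := P)
    (fun v => {ω | s ≤ ∑ i, min ((∑ l, v l * z (i, l) ω) ^ 4) b})
    (fun v hv => hfix v (Finset.mem_filter.1 hv).2)
  refine (measureReal_mono ?_ (measure_ne_top _ _)).trans (hU.trans ?_)
  · intro ω hω
    simp only [Set.mem_ofPred_eq] at hω
    push Not at hω
    obtain ⟨v, hv, hv1, hlt⟩ := hω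
    simp only [Set.mem_iUnion]
    exact ⟨v, Finset.mem_filter.2 ⟨hv, hv1⟩, hlt.le⟩
  · calc S.card * Real.exp (-(12 * k * L)) ≤
        Real.exp (11 * k * L) * Real.exp (-(12 * k * L)) := by gcongr
      _ = Real.exp (-(k * L)) := by rw [← Real.exp_add]; ring_nf
      _ ≤ Real.exp (-L) := by
          gcongr
          nlinarith
      _ = 1 / n := by rw [Real.exp_neg, Real.exp_log hn0, one_div]

/-- The exponential rate for the deviation of the squared norm of a sparse combination of rows. -/
noncomputable def sparseRate (c : ℝ≥0) : ℝ := sqRate c ^ 2 / 25600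

/-- Combinations of at most `m` rows with unit coefficient vector have squared norm at most
`1.05 k`, simultaneously over the grid. -/
lemma IsFactorVector.prob_sparse (h : IsFactorVector P c κ z) (hn : 3 ≤ n) (m : ℕ)
    (hm : 24 * (m * Real.log n) ≤ sparseRate c * k) :
    P.real {ω | ¬ ∀ I : Finset (Fin n), I.card = m → ∀ x ∈ gridVectors (n ^ 10) I,
      ∑ i, x i ^ 2 ≤ 1 → ∑ l, (∑ i, x i * z (i, l) ω) ^ 2 ≤ 21 / 20 * k} ≤
      Real.exp (-(sparseRate c * k / 2)) := by
  classical
  have hn0 : (0 : ℝ) < n := by positivity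
  set a := sqRate c with ha_def
  have ha : 0 < a := sqRate_pos c
  have ha1 : a ≤ 1 := sqRate_le_one c
  set L := Real.log n with hL
  have hcol : IsFactorVector P c κ (fun p : Fin k × Fin n => z (p.2, p.1)) :=
    h.comp_injective (g := Prod.swap) Prod.swap_injective
  have hfix : ∀ x : Fin n → ℝ, ∑ i, x i ^ 2 ≤ 1 →
      P.real {ω | 21 / 20 * k ≤ ∑ l, (∑ i, x i * z (i, l) ω) ^ 2} ≤
        Real.exp (-(sparseRate c * k)) := by
    intro x hx
    refine (hcol.prob_sq_le hx (l := a ^ 2 / 640) (by positivity) (by nlinarith)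
      (21 / 20 * k)).trans (Real.exp_le_exp.2 (le_of_eq ?_))
    simp only [Fintype.card_fin, sparseRate, ← ha_def]
    field_simp
    ring
  set S := ((Finset.powersetCard m (Finset.univ : Finset (Fin n))).biUnion
    fun I => gridVectors (n ^ 10) I).filter fun x => ∑ i, x i ^ 2 ≤ 1
  have hS : (S.card : ℝ) ≤ Real.exp (12 * (m * L)) := by
    have h1 : (S.card : ℝ) ≤ (n : ℝ) ^ m * Real.exp (11 * m * L) := by
      have h2 : (S.card : ℝ) ≤
          ((Finset.powersetCard m (Finset.univ : Finset (Fin n))).biUnion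
            fun I => gridVectors (n ^ 10) I).card := by
        exact_mod_cast Finset.card_filter_le _ _
      have h3 : (((Finset.powersetCard m (Finset.univ : Finset (Fin n))).biUnion
            fun I => gridVectors (n ^ 10) I).card : ℝ) ≤
          ∑ I ∈ Finset.powersetCard m (Finset.univ : Finset (Fin n)),
            ((gridVectors (n ^ 10) I).card : ℝ) := by
        exact_mod_cast Finset.card_biUnion_le
      have h4 : ∑ I ∈ Finset.powersetCard m (Finset.univ : Finset (Fin n)),
            ((gridVectors (n ^ 10) I).card : ℝ) ≤
          ∑ _I ∈ Finset.powersetCard m (Finset.univ : Finset (Fin n)),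
            Real.exp (11 * m * L) := Finset.sum_le_sum fun I hI =>
        card_grid_le_exp hn I (Finset.mem_powersetCard.1 hI).2
      rw [Finset.sum_const, Finset.card_powersetCard, Finset.card_univ, Fintype.card_fin,
        nsmul_eq_mul] at h4
      have h5 : ((n.choose m : ℕ) : ℝ) ≤ (n : ℝ) ^ m := by
        exact_mod_cast Nat.choose_le_pow n m
      refine h2.trans (h3.trans (h4.trans ?_))
      gcongr
    refine h1.trans (le_of_eq ?_)
    have : (n : ℝ) ^ m = Real.exp (m * L) := by
      rw [Real.exp_nat_mul, hL, Real.exp_log hn0]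
    rw [this, ← Real.exp_add]
    ring_nf
  have hU := measureReal_biUnion_le_card_mul S (P := P)
    (fun x => {ω | 21 / 20 * k ≤ ∑ l, (∑ i, x i * z (i, l) ω) ^ 2})
    (fun x hx => hfix x (Finset.mem_filter.1 hx).2)
  refine (measureReal_mono ?_ (measure_ne_top _ _)).trans (hU.trans ?_)
  · intro ω hω
    simp only [Set.mem_ofPred_eq] at hω
    push Not at hω
    obtain ⟨I, hI, x, hx, hx1, hlt⟩ := hω
    simp only [Set.mem_iUnion]
    exact ⟨x, Finset.mem_filter.2 ⟨Finset.mem_biUnion.2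
      ⟨I, Finset.mem_powersetCard.2 ⟨Finset.subset_univ _, hI⟩, hx⟩, hx1⟩, hlt.le⟩
  · calc S.card * Real.exp (-(sparseRate c * k)) ≤
        Real.exp (12 * (m * L)) * Real.exp (-(sparseRate c * k)) := by gcongr
      _ = Real.exp (12 * (m * L) - sparseRate c * k) := by rw [← Real.exp_add]; ring_nf
      _ ≤ _ := by
          apply Real.exp_le_exp.2
          linarith

end

/-! ### Inconsistency for small samples -/

/-- With about `γ k / (24 log n)` rows, the sparse grid is small enough for the union bound, while
values above `96 / γ * log n` on that many rows would exceed the sparse bound. -/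
lemma exists_sparsity_level {γ L ℓ : ℝ} {k : ℕ} (hγ : 0 < γ) (hγ1 : γ ≤ 1) (hL : 1 ≤ L)
    (hLℓ : L ≤ 2 * ℓ) (hk : 1 ≤ k) (hℓ : 96 / γ * ℓ ≤ k) :
    ∃ m : ℕ, m ≤ k ∧ 24 * (m * L) ≤ γ * k ∧ 11 / 10 * k < m * (96 / γ * L) := by
  have hk0 : (0 : ℝ) < k := by exact_mod_cast hk
  have hL0 : 0 < L := by linarith
  have hx0 : 0 ≤ γ * k / (24 * L) := by positivity
  have h1 : (⌊γ * k / (24 * L)⌋₊ : ℝ) ≤ γ * k / (24 * L) := Nat.floor_le hx0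
  have h2 : γ * k / (24 * L) < ⌊γ * k / (24 * L)⌋₊ + 1 := Nat.lt_floor_add_one _
  have h3 : 2 ≤ γ * k / (24 * L) := by
    rw [le_div_iff₀ (by positivity)]
    rw [div_mul_eq_mul_div, div_le_iff₀ hγ] at hℓ
    linarith
  have h4 : γ * k / (24 * L) * (24 * L) = γ * k := by field_simp
  generalize ⌊γ * k / (24 * L)⌋₊ = m at h1 h2
  generalize γ * k / (24 * L) = x at *
  refine ⟨m, ?_, ?_, ?_⟩
  · have h5 : (m : ℝ) * 1 ≤ m * (24 * L) := by gcongr; linarith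
    have h6 : (m : ℝ) * (24 * L) ≤ x * (24 * L) := by gcongr
    have h7 : γ * k ≤ 1 * k := by gcongr
    exact_mod_cast (by linarith : (m : ℝ) ≤ k)
  · have h6 : (m : ℝ) * (24 * L) ≤ x * (24 * L) := by gcongr
    linarith
  · have h8 : x / 2 * (96 / γ * L) ≤ m * (96 / γ * L) := by
      gcongr
      linarith
    have h9 : x / 2 * (96 / γ * L) = 2 * k := by
      have : x / 2 * (96 / γ * L) = 2 * (x * (24 * L)) / γ := by ring
      rw [this, h4]
      field_simp
    linarith

/-- The bound on the truncated fourth moments is a small multiple of `k ^ 2`. -/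
lemma truncated_bound_le {K M κ C₀ n k L ℓ c₁ : ℝ} (hK : 1 ≤ K) (hM : 0 ≤ M) (hκ : κ ≤ C₀)
    (hn : 0 ≤ n) (hk : 0 < k) (hL : 1 ≤ L) (hLℓ : L ≤ 2 * ℓ)
    (hnk : n ≤ c₁ * k ^ 2) (hC : 0 < C₀ + M) (hc₁ : c₁ * (C₀ + M) ≤ 1 / 10)
    (hℓ : 960 * K ^ 2 * ℓ ^ 3 ≤ k) :
    n * (κ + M / (K * L) ^ 2) + 12 * (K * L) ^ 2 * (k * L) ≤ 1 / 5 * k ^ 2 := by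
  have hKL : 1 ≤ (K * L) ^ 2 := one_le_pow₀ (one_le_mul_of_one_le_of_one_le hK hL)
  have h1 : M / (K * L) ^ 2 ≤ M := div_le_self hM hKL
  have h2 : n * (κ + M / (K * L) ^ 2) ≤ 1 / 10 * k ^ 2 := by
    calc n * (κ + M / (K * L) ^ 2) ≤ n * (C₀ + M) := by gcongr
      _ ≤ c₁ * k ^ 2 * (C₀ + M) := by gcongr
      _ = c₁ * (C₀ + M) * k ^ 2 := by ring
      _ ≤ _ := by gcongr
  have h3 : 12 * (K * L) ^ 2 * (k * L) ≤ 1 / 10 * k ^ 2 := by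
    have hL0 : 0 ≤ L := by linarith
    calc 12 * (K * L) ^ 2 * (k * L) = 12 * K ^ 2 * k * L ^ 3 := by ring
      _ ≤ 12 * K ^ 2 * k * (2 * ℓ) ^ 3 := by gcongr
      _ = 1 / 10 * k * (960 * K ^ 2 * ℓ ^ 3) := by ring
      _ ≤ 1 / 10 * k * k := by gcongr
      _ = _ := by ring
  linarith

/-- The upper bound on the objective near a signed permutation contradicts the lower bound on its
maximum. -/
lemma objective_bounds_incompatible {k s d T F : ℝ} (hk : 40000 ≤ k) (hs : s ^ 2 = k) (hs0 : 0 < s)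
    (hd : d < k ^ 2 * s / 100) (hT : T ≤ 1 / 5 * k ^ 2) (hF : 21 ^ 3 * F ≤ k ^ 3 / 100)
    (h : k ^ 3 / 3 - 2 * k ^ 2 * s - s * d ≤
      (21 / 20) ^ 3 * (4 / 27 * k * (121 / 100 * k ^ 2 + T + 4)) + 21 ^ 3 * F) : False := by
  have hk0 : 0 < k := by linarith
  have hk3 : 0 < k ^ 3 := by positivity
  have h1 : s * d ≤ k ^ 3 / 100 := by
    calc s * d ≤ s * (k ^ 2 * s / 100) := by gcongr
      _ = s ^ 2 * k ^ 2 / 100 := by ring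
      _ = _ := by rw [hs]; ring
  have h2 : 200 ≤ s := by
    by_contra hcon
    nlinarith
  have h3 : 2 * k ^ 2 * s ≤ k ^ 3 / 100 := by
    have : 200 * s ≤ k := by nlinarith
    calc 2 * k ^ 2 * s = k ^ 2 * (200 * s) / 100 := by ring
      _ ≤ k ^ 2 * k / 100 := by gcongr
      _ = _ := by ring
  have h4 : k * (121 / 100 * k ^ 2 + T + 4) ≤ 142 / 100 * k ^ 3 := by
    calc k * (121 / 100 * k ^ 2 + T + 4) ≤ k * (142 / 100 * k ^ 2) := by
          gcongr
          nlinarith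
      _ = _ := by ring
  linarith

lemma sparseRate_pos (c : ℝ≥0) : 0 < sparseRate c := by
  have := sqRate_pos c
  unfold sparseRate
  positivity

lemma sparseRate_le_one (c : ℝ≥0) : sparseRate c ≤ 1 := by
  have h0 := sqRate_pos c
  have h1 := sqRate_le_one c
  unfold sparseRate
  nlinarith

/-- Outside five events of vanishing probability (an entry above `n`, a large sum of all fourth
powers, a large truncated fourth moment on the grid, a long sparse combination of rows, irregular
Gram-Schmidt projections) no maximizer is within `δ` of `Rstar`. -/
theorem varimax_inconsistent (c : ℝ≥0) (C₀ δ : ℝ) (hC₀ : 3 < C₀) (hδ_pos : 0 < δ)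
    (hδ : δ ≤ 1 / 2) :
    ∃ c₁ : ℝ, 0 < c₁ ∧ ∀ ε : ℝ, 0 < ε → ∃ N : ℕ, ∀ n k : ℕ, N ≤ n → N ≤ k →
      k < n → (n : ℝ) ≤ c₁ * (k : ℝ) ^ 2 →
      ∀ κ : ℝ, 3 < κ → κ ≤ C₀ →
      ∀ (Ω : Type*) [MeasurableSpace Ω] (P : Measure Ω) [IsProbabilityMeasure P]
        (Z : Ω → Matrix (Fin n) (Fin k) ℝ) (Rstar : Matrix (Fin k) (Fin k) ℝ)
        (Rhat : Ω → Matrix (Fin k) (Fin k) ℝ),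
        IsFactorMatrix P c κ Z →
        Rstar ∈ Matrix.orthogonalGroup (Fin k) ℝ →
        (∀ᵐ ω ∂P, IsVarimax (Z ω * Rstar) (Rhat ω)) →
        1 - ε ≤ P.real {ω | δ ≤ rotationDist Rstar (Rhat ω)} := by
  obtain ⟨γ, hγ⟩ : ∃ γ, γ = sparseRate c := ⟨_, rfl⟩
  obtain ⟨M, hM⟩ : ∃ M, M = eighthBound (sqRate c) := ⟨_, rfl⟩
  have hγ0 : 0 < γ := hγ ▸ sparseRate_pos c
  have hγ1 : γ ≤ 1 := hγ ▸ sparseRate_le_one c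
  have hM0 : 0 < M := by
    have := sqRate_pos c
    rw [hM, eighthBound]; positivity
  obtain ⟨K, hK⟩ : ∃ K, K = 96 / γ := ⟨_, rfl⟩
  have hK1 : 1 ≤ K := by
    rw [hK, le_div_iff₀ hγ0]
    linarith
  -- small enough that `n E ⟨u, z⟩ ^ 4 ≪ k ^ 2` and `21 ^ 3 ∑ z ^ 4 ≪ k ^ 3` for `n ≤ c₁ k ^ 2`
  obtain ⟨c₁, hc₁⟩ : ∃ c₁, c₁ = 1 / (1000000 * (C₀ + 1 + M)) := ⟨_, rfl⟩
  have hc0 : 0 < c₁ := by rw [hc₁]; positivity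
  have hc2 : c₁ * (1000000 * (C₀ + 1 + M)) = 1 := by
    rw [hc₁]; field_simp
  have hcC : 0 < c₁ * C₀ := by positivity
  have hcM : 0 < c₁ * M := by positivity
  refine ⟨c₁, hc0, fun ε hε => ?_⟩
  have hlim : Filter.Tendsto (fun k : ℕ => (C₀ + M + 1) / k + Real.exp (-(γ * k / 2)) +
      200 * C₀ / √k) Filter.atTop (nhds (0 + 0 + 0)) := by
    have hk := tendsto_natCast_atTop_atTop (R := ℝ)
    refine ((tendsto_const_nhds.div_atTop hk).add ?_).add
      (tendsto_const_nhds.div_atTop (Real.tendsto_sqrt_atTop.comp hk))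
    exact Real.tendsto_exp_neg_atTop_nhds_zero.comp
      ((hk.const_mul_atTop hγ0).atTop_div_const two_pos)
  rw [add_zero, add_zero] at hlim
  obtain ⟨N, hN⟩ := Filter.eventually_atTop.1 ((hlim.eventually_le_const hε).and
    ((eventually_log_pow_le (960 * K ^ 2) 3).and ((eventually_log_pow_le (96 / γ) 1).and
      (Filter.eventually_ge_atTop 40000))))
  refine ⟨N, fun n k _ hk hkn hnk κ hκ hκC Ω _ P _ Z Rstar Rhat hZ hR hopt => ?_⟩
  obtain ⟨hε', hlog3, hlog1, hk4⟩ := hN k hk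
  rw [pow_one] at hlog1
  have hk4' : (40000 : ℝ) ≤ k := by exact_mod_cast hk4
  have hk0 : (0 : ℝ) < k := by linarith
  have hkn' : (k : ℝ) ≤ n := by exact_mod_cast hkn.le
  have hn0 : (0 : ℝ) < n := by linarith
  have hn3 : 3 ≤ n := by omega
  have hL1 : 1 ≤ Real.log n := by
    rw [Real.le_log_iff_exp_le hn0]
    have := Real.exp_one_lt_d9
    linarith
  have hLℓ : Real.log n ≤ 2 * Real.log k := by
    have h1 : (n : ℝ) ≤ (k : ℝ) ^ 2 := by
      refine hnk.trans (mul_le_of_le_one_left (by positivity) ?_)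
      linarith
    have h2 := Real.log_le_log hn0 h1
    rwa [Real.log_pow, Nat.cast_ofNat] at h2
  obtain ⟨m, hmk, hm1, hm2⟩ := exists_sparsity_level hγ0 hγ1 hL1 hLℓ (by omega) hlog1
  rw [← hK] at hm2
  have hT := truncated_bound_le hK1 hM0.le hκC hn0.le hk0 hL1 hLℓ hnk (by linarith)
    (by linarith) hlog3
  obtain ⟨z, hz, hzZ⟩ := hZ.exists_measurable
  have hw : IsFactorVector P c κ (fun p : Fin k × Fin k => z (Fin.castLE hkn.le p.1, p.2)) :=
    hz.comp_injective (g := fun p : Fin k × Fin k => (Fin.castLE hkn.le p.1, p.2))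
      fun p q hpq => by
        simp only [Prod.mk.injEq, Fin.castLE_inj] at hpq
        exact Prod.ext hpq.1 hpq.2
  set A1 := {ω | ∃ p, (n : ℝ) < |z p ω|}
  set A2 := {ω | (n : ℝ) * k ≤ |∑ p, z p ω ^ 4 - Fintype.card (Fin n × Fin k) * κ|}
  set A3 := {ω | ¬ ∀ v ∈ gridVectors (n ^ 10) (Finset.univ : Finset (Fin k)), ∑ l, v l ^ 2 ≤ 1 →
      ∑ i, min ((∑ l, v l * z (i, l) ω) ^ 4) ((K * Real.log n) ^ 2) ≤
        n * (κ + eighthBound (sqRate c) / (K * Real.log n) ^ 2) +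
          12 * (K * Real.log n) ^ 2 * (k * Real.log n)}
  set A4 := {ω | ¬ ∀ I : Finset (Fin n), I.card = m → ∀ x ∈ gridVectors (n ^ 10) I,
      ∑ i, x i ^ 2 ≤ 1 → ∑ l, (∑ i, x i * z (i, l) ω) ^ 2 ≤ 21 / 20 * k}
  set A5 := {ω | (k : ℝ) ^ 2 * √k / 100 ≤
    gsDeviation fun p : Fin k × Fin k => z (Fin.castLE hkn.le p.1, p.2) ω}
  have hs0 : 0 < √(k : ℝ) := Real.sqrt_pos.2 hk0
  have p1 : P.real A1 ≤ C₀ / k := by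
    refine (hz.prob_exists_large hn0).trans ?_
    simp only [Fintype.card_prod, Fintype.card_fin, Nat.cast_mul]
    have hn1 : (1 : ℝ) ≤ n := by linarith
    rw [div_le_div_iff₀ (by positivity) hk0]
    calc (n : ℝ) * k * κ * k ≤ n * n * C₀ * n := by gcongr
      _ = C₀ * (n ^ 3 * 1) := by ring
      _ ≤ C₀ * (n ^ 3 * n) := by gcongr
      _ = _ := by ring
  have p2 : P.real A2 ≤ M / k := by
    refine (hz.prob_sum_pow_four (by positivity)).trans ?_
    simp only [Fintype.card_prod, Fintype.card_fin, Nat.cast_mul]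
    rw [← hM]
    have e : n * k * M / ((n : ℝ) * k) ^ 2 = M / (n * k) := by field_simp
    rw [e]
    gcongr
    nlinarith
  have p3 : P.real A3 ≤ 1 / k :=
    (hz.prob_grid_truncated hn3 (by omega) hκ.le (by positivity)).trans
      (by gcongr)
  have p4 : P.real A4 ≤ Real.exp (-(γ * k / 2)) := by
    have := hz.prob_sparse hn3 m (by rwa [← hγ])
    rwa [← hγ] at this
  have p5 : P.real A5 ≤ 200 * C₀ / √k := by
    refine (hw.prob_gsDeviation_ge hκ.le (by positivity)).trans ?_
    have e : 2 * (κ - 1) * (k : ℝ) ^ 2 / (k ^ 2 * √k / 100) = 200 * (κ - 1) / √k := by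
      field_simp; ring
    rw [e]
    gcongr
    linarith
  have hsub : (Set.univ : Set Ω) ≤ᵐ[P]
      ({ω | δ ≤ rotationDist Rstar (Rhat ω)} ∪ (A1 ∪ A2 ∪ A3 ∪ A4 ∪ A5) : Set Ω) := by
    filter_upwards [hopt, hzZ] with ω ho hzω _
    by_contra hcon
    have hcon' : ω ∉ {ω | δ ≤ rotationDist Rstar (Rhat ω)} ∪ (A1 ∪ A2 ∪ A3 ∪ A4 ∪ A5) := hcon
    simp only [Set.mem_union, not_or] at hcon'
    obtain ⟨n0, ⟨⟨⟨n1, n2⟩, n3⟩, n4⟩, n5⟩ := hcon'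
    simp only [A1, A2, A3, A4, A5, Set.mem_ofPred_eq, not_exists, not_lt, not_le, not_not]
      at n0 n1 n2 n3 n4 n5
    have hV := ho.mul_transpose hR
    rw [hzω] at hV
    obtain ⟨Q, hQ, hVQ⟩ := exists_of_rotationDist_lt (by omega) hR n0
    have hVQ' : ∑ i, ∑ j, ((Rhat ω * Rstarᵀ) i j - Q i j) ^ 2 ≤ k / 4 := by
      have : δ ^ 2 * k ≤ (1 / 2) ^ 2 * k := by gcongr
      linarith
    have hlow := hV.objective_ge (by omega) hkn.le
    have hup := objective_le_of_near_signedPermutation hV.1 hQ hVQ' fun u hu =>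
      sum_pow_four_le_of_events (by omega) hkn.le (by omega) (fun i j => n1 (i, j))
        (hmk.trans hkn.le) hm2 n4 n3 hu
    refine objective_bounds_incompatible hk4' (Real.sq_sqrt hk0.le) hs0 n5 (hM ▸ hT) ?_
      (hlow.trans hup)
    have hF := (abs_lt.1 n2).2
    simp only [Fintype.card_prod, Fintype.card_fin, Nat.cast_mul, Fintype.sum_prod_type] at hF
    have h1 : n * k * (κ + 1) ≤ c₁ * k ^ 2 * k * (C₀ + 1) := by gcongr
    have h2 : 21 ^ 3 * (c₁ * (C₀ + 1)) ≤ 1 / 100 := by linarith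
    have h3 : 21 ^ 3 * (c₁ * (C₀ + 1)) * k ^ 3 ≤ 1 / 100 * (k : ℝ) ^ 3 := by gcongr
    linarith
  have h1 : 1 ≤ P.real ({ω | δ ≤ rotationDist Rstar (Rhat ω)} ∪ (A1 ∪ A2 ∪ A3 ∪ A4 ∪ A5)) := by
    rw [← probReal_univ (μ := P)]
    exact ENNReal.toReal_mono (measure_ne_top _ _) (measure_mono_ae hsub)
  have h2 : P.real (A1 ∪ A2 ∪ A3 ∪ A4 ∪ A5) ≤
      P.real A1 + P.real A2 + P.real A3 + P.real A4 + P.real A5 := by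
    have e1 := measureReal_union_le (μ := P) (A1 ∪ A2 ∪ A3 ∪ A4) A5
    have e2 := measureReal_union_le (μ := P) (A1 ∪ A2 ∪ A3) A4
    have e3 := measureReal_union_le (μ := P) (A1 ∪ A2) A3
    have e4 := measureReal_union_le (μ := P) A1 A2
    linarith
  have h3 := measureReal_union_le (μ := P) {ω | δ ≤ rotationDist Rstar (Rhat ω)}
    (A1 ∪ A2 ∪ A3 ∪ A4 ∪ A5)
  rw [add_div, add_div] at hε'
  linarith

end VarimaxRotation

theorem theorem1 (c : ℝ≥0) (C₀ δ : ℝ) (hC₀ : 3 < C₀) (hδ_pos : 0 < δ) (hδ_le : δ ≤ 1 / 2) :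
    (∃ C : ℝ, 0 < C ∧ ∀ ε : ℝ, 0 < ε → ∃ N : ℕ, ∀ n k : ℕ, N ≤ n → 1 ≤ k →
      ∀ κ : ℝ, 3 < κ → κ ≤ C₀ →
      C * max ((k : ℝ) * Real.log n / (κ - 3) ^ 2)
        ((k : ℝ) ^ 2 * Real.log n ^ 2 / (κ - 3)) ≤ (n : ℝ) →
      ∀ (Ω : Type*) [MeasurableSpace Ω] (P : Measure Ω) [IsProbabilityMeasure P]
        (Z : Ω → Matrix (Fin n) (Fin k) ℝ) (Rstar : Matrix (Fin k) (Fin k) ℝ)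
        (Rhat : Ω → Matrix (Fin k) (Fin k) ℝ),
        VarimaxRotation.IsFactorMatrix P c κ Z →
        Rstar ∈ Matrix.orthogonalGroup (Fin k) ℝ →
        (∀ᵐ ω ∂P, VarimaxRotation.IsVarimax (Z ω * Rstar) (Rhat ω)) →
        P.real {ω | δ ≤ VarimaxRotation.rotationDist Rstar (Rhat ω)} ≤ ε) ∧
    (∃ c₁ : ℝ, 0 < c₁ ∧ ∀ ε : ℝ, 0 < ε → ∃ N : ℕ, ∀ n k : ℕ, N ≤ n → N ≤ k →
      k < n → (n : ℝ) ≤ c₁ * (k : ℝ) ^ 2 →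
      ∀ κ : ℝ, 3 < κ → κ ≤ C₀ →
      ∀ (Ω : Type*) [MeasurableSpace Ω] (P : Measure Ω) [IsProbabilityMeasure P]
        (Z : Ω → Matrix (Fin n) (Fin k) ℝ) (Rstar : Matrix (Fin k) (Fin k) ℝ)
        (Rhat : Ω → Matrix (Fin k) (Fin k) ℝ),
        VarimaxRotation.IsFactorMatrix P c κ Z →
        Rstar ∈ Matrix.orthogonalGroup (Fin k) ℝ →
        (∀ᵐ ω ∂P, VarimaxRotation.IsVarimax (Z ω * Rstar) (Rhat ω)) →
        1 - ε ≤ P.real {ω | δ ≤ VarimaxRotation.rotationDist Rstar (Rhat ω)}) :=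
  ⟨VarimaxRotation.varimax_consistent c C₀ δ hC₀ hδ_pos,
    VarimaxRotation.varimax_inconsistent c C₀ δ hC₀ hδ_pos hδ_le⟩
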